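/- Let $G=\mathrm{SO}(3)$ and let $K\cong\mathrm{SO}(2)$ be the stabilizer of the first basis vector $e_1$ of $\mathbb R^3$, so that $G/K=\mathbb S^2$, $gK\mapsto ge_1$. In $\mathfrak g=\mathfrak{so}(3)$ put $X=E_{12}-E_{21}$, $Y=E_{13}-E_{31}$, $Z=E_{23}-E_{32}$ and $\langle A,B\rangle=-\tfrac12\operatorname{tr}(AB)$; then $\mathfrak k=\mathbb RZ$ is the Lie algebra of $K$. The map $$G\times\mathbb R^+\to T\mathbb S^2,\qquad (g,x)\mapsto \tfrac{d}{dt}\Big|_{0}\,g\exp(txX)K ,$$ is a $G$-equivariant diffeomorphism ($G$ acts on $G\times\mathbb R^+$ by left translations of the first factor) onto the punctured tangent bundle $T^+\mathbb S^2=T\mathbb S^2\setminus\{\text{zero section}\}$, and $T^+\mathbb S^2$ is identified with $G\times\mathbb R^+$ by it. Let $J_c$ be the canonical complex structure on $T^+\mathbb S^2\cong G\times\mathbb R^+$, that is, the pull-back of the complex structure of $G^{\mathbb C}/K^{\mathbb C}=\mathrm{SO}(3,\mathbb C)/\mathrm{SO}(2,\mathbb C)$ under $(g,x)\mapsto g\exp(\mathrm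 i xX)K^{\mathbb C}$. For a smooth function $\mathbf a\colon\mathbb R^+\to\mathfrak g$ let $\tilde\theta^{\mathbf a}$ be the $1$-form on $G\times\mathbb R^+$ with $\tilde\theta^{\mathbf a}_{(g,x)}(g\xi,\,t\,\partial/\partial x)=\langle \mathbf a(x),\xi\rangle$ for $\xi\in\mathfrak g$, $t\in\mathbb R$. A $2$-form $\omega$ on $G\times\mathbb R^+\cong T^+\mathbb S^2$ determines a $G$-invariant Kähler structure associated to $J_c$ (that is, $\omega$ is smooth, closed, $G$-invariant and $J_c$-invariant, and $\mathbf g(u,v)=\omega(J_cu,v)$ is positive-definite) if and only if $\omega=d\tilde\theta^{\mathbf a}$ for a vector-function $$\mathbf a(x)=f'(x)X+\frac{c_Z}{\cosh x}Z+\frac{c_Y}{\sinh x}Y ,$$ where $c_Z,c_Y\in\mathbb R$ and $f\in C^\infty(\mathbb R^+,\mathbb R)$ satisfy, for all $x\in\mathbb R^+$, $$f''(x)>0\qquad\text{and}\qquad \frac{f''(x)f'(x)}{\cosh x\,\sinh x}-\frac{c_Z^2}{\cosh^4x}-\frac{c_Y^2}{\sinh^4x}>0 .$$ In particular, if $c_Z=c_Y=0$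 (and the above conditions hold), then the function $Q(g,x)=2f(x)$ is a potential function of the Kähler structure $(\omega,J_c)$, that is, $\omega=\mathrm i\,\bar\partial\partial Q$, where $\partial$ and $\bar\partial$ are taken with respect to $J_c$. -/

import Mathlib

noncomputable section

namespace PuncturedTS2

/-! ### The Lie algebra `so(3)`, its trace form, and the manifold `G × W⁺` -/

/-- Real `3 × 3` matrices. -/
abbrev Mat := Matrix (Fin 3) (Fin 3) ℝ

/-- Complex `3 × 3` matrices. -/
abbrev MatC := Matrix (Fin 3) (Fin 3) ℂ

/-- `X = E₁₂ - E₂₁`, a basis of the Cartan subspace `𝔞`. -/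
def X : Mat := !![0, 1, 0; -1, 0, 0; 0, 0, 0]

/-- `Y = E₁₃ - E₃₁`; the vectors `X, Y` span `𝔪`. -/
def Y : Mat := !![0, 0, 1; 0, 0, 0; -1, 0, 0]

/-- `Z = E₂₃ - E₃₂`, which spans `𝔨`, the Lie algebra of `K = SO(2)` (the stabilizer of the
first basis vector of `ℝ³`). -/
def Z : Mat := !![0, 0, 0; 0, 0, 1; 0, -1, 0]

/-- The invariant form `⟨A, B⟩ = -½ tr (A B)` on `so(3)`. -/
def traceForm (A B : Mat) : ℝ := -(1 / 2) * (A * B).trace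

/-- The vector space in which `G × W⁺` is embedded: pairs of a `3 × 3` matrix (an array of nine
real numbers, with the product topology) and a real number. -/
abbrev Amb := (Fin 3 → Fin 3 → ℝ) × ℝ

/-- The matrix component of an element of `Amb`. -/
abbrev mat (m : Amb) : Mat := Matrix.of m.1

/-- The set `G × W⁺`, where `G = SO(3)` and `W⁺ = {x X : x > 0}` is identified with the open
half-line of the coordinates `x`. -/
def GW : Set Amb := {m | mat m ∈ Matrix.specialOrthogonalGroup (Fin 3) ℝ ∧ 0 < m.2}

lemma transpose_mul_self_of_mem {g : Mat} (hg : g ∈ Matrix.specialOrthogonalGroup (Fin 3) ℝ) :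
    g.transpose * g = 1 := by
  have h := (Matrix.mem_specialOrthogonalGroup_iff.1 hg).1
  rw [Matrix.mem_orthogonalGroup_iff'] at h
  simpa [Matrix.star_eq_conjTranspose] using h

lemma mul_transpose_self_of_mem {g : Mat} (hg : g ∈ Matrix.specialOrthogonalGroup (Fin 3) ℝ) :
    g * g.transpose = 1 :=
  mul_eq_one_comm.1 (transpose_mul_self_of_mem hg)

/-- The tangent space of `G × W⁺` at `(g, x)`: the pairs `(g ξ, t)` with `ξ` a skew-symmetric
matrix and `t` a real number, that is, `(ξˡ(g), t ∂/∂x)`. -/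
def tangent (m : Amb) : Submodule ℝ Amb where
  carrier := {v | ((mat m).transpose * mat v).transpose = -((mat m).transpose * mat v)}
  add_mem' := by
    intro a b ha hb
    change ((mat m).transpose * (mat a + mat b)).transpose
      = -((mat m).transpose * (mat a + mat b))
    rw [Matrix.mul_add, Matrix.transpose_add, ha, hb, neg_add]
  zero_mem' := by
    change ((mat m).transpose * (0 : Mat)).transpose = -((mat m).transpose * (0 : Mat))
    simp
  smul_mem' := by
    intro c a ha
    change ((mat m).transpose * (c • mat a)).transpose = -((mat m).transpose * (c • mat a))
    rw [Matrix.mul_smul, Matrix.transpose_smul, ha, smul_neg]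

/-! ### Differential forms on `G × W⁺` -/

/-- An `F`-valued `k`-form on `G × W⁺` (no smoothness yet): an alternating `k`-linear map on
each tangent space. -/
abbrev Form (F : Type) [AddCommGroup F] [Module ℝ F] (k : ℕ) :=
  ∀ m : GW, tangent m.1 [⋀^Fin k]→ₗ[ℝ] F

section Forms

variable {F : Type} [NormedAddCommGroup F] [NormedSpace ℝ F] {k : ℕ}

/-- On the open set `U`, the form `α` on `G × W⁺` is the restriction of the smooth form `η` of
the ambient vector space. -/
def IsSmoothExtension (α : Form F k) (U : Set Amb) (η : Amb → Amb [⋀^Fin k]→L[ℝ] F) : Prop :=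
  ContDiffOn ℝ (⊤ : ℕ∞) η U ∧
    ∀ m : GW, m.1 ∈ U → ∀ v : Fin k → tangent m.1, η m.1 (fun i => (v i : Amb)) = α m v

/-- A form on the embedded submanifold `G × W⁺` is smooth if near every point it is the
restriction of a smooth ambient form. -/
def IsSmoothForm (α : Form F k) : Prop :=
  ∀ m : GW, ∃ U : Set Amb, IsOpen U ∧ m.1 ∈ U ∧ ∃ η, IsSmoothExtension α U η

/-- `β = dα` for a smooth form `α` on `G × W⁺`: near every point, `β` is the restriction of the
exterior derivative of a smooth ambient form that restricts to `α`. -/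
def IsExtDeriv (α : Form F k) (β : Form F (k + 1)) : Prop :=
  ∀ m : GW, ∃ U : Set Amb, IsOpen U ∧ m.1 ∈ U ∧ ∃ η, IsSmoothExtension α U η ∧
    ∀ n : GW, n.1 ∈ U → ∀ v : Fin (k + 1) → tangent n.1,
      extDeriv η n.1 (fun i => (v i : Amb)) = β n v

end Forms

/-- A function on `G × W⁺` as a `0`-form. -/
def zeroForm (Q : GW → ℝ) : Form ℝ 0 := fun m => AlternatingMap.constOfIsEmpty ℝ _ _ (Q m)

/-- The left `G`-invariant `1`-form `θ̃ᵃ` of a vector-function `a : W⁺ → so(3)`: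
`θ̃ᵃ (ξˡ(g), t ∂/∂x) = ⟨a(x), ξ⟩` at the point `(g, x)`. -/
def theta (a : ℝ → Mat) : Form ℝ 1 := fun m =>
  AlternatingMap.ofSubsingleton ℝ _ _ 0
    { toFun := fun v => traceForm (a m.1.2) ((mat m.1).transpose * mat v.1)
      map_add' := by
        intro v w
        change traceForm _ ((mat m.1).transpose * (mat v.1 + mat w.1)) = _
        rw [traceForm, Matrix.mul_add, Matrix.mul_add, Matrix.trace_add, mul_add]
        rfl
      map_smul' := by
        intro c v
        change traceForm _ ((mat m.1).transpose * (c • mat v.1)) = _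
        rw [traceForm, Matrix.mul_smul, Matrix.mul_smul, Matrix.trace_smul, smul_eq_mul,
          mul_left_comm]
        rfl }

/-! ### The left action of `G = SO(3)` -/

/-- The action `h · (g, x) = (h g, x)` of `SO(3)` on `G × W⁺`. -/
def leftMul (h : Matrix.specialOrthogonalGroup (Fin 3) ℝ) (m : GW) : GW :=
  ⟨(Matrix.of.symm (h.1 * mat m.1), m.1.2), mul_mem h.2 m.2.1, m.2.2⟩

/-- The differential of the action of `h`, `(v, t) ↦ (h v, t)`. -/
def leftMulTangent (h : Matrix.specialOrthogonalGroup (Fin 3) ℝ) (m : GW) :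
    tangent m.1 →ₗ[ℝ] tangent (leftMul h m).1 where
  toFun v := ⟨(Matrix.of.symm (h.1 * mat v.1), v.1.2), by
    have h1 : (h.1 * mat m.1).transpose * (h.1 * mat v.1) = (mat m.1).transpose * mat v.1 := by
      rw [Matrix.transpose_mul, Matrix.mul_assoc, ← Matrix.mul_assoc h.1.transpose,
        transpose_mul_self_of_mem h.2, Matrix.one_mul]
    change ((h.1 * mat m.1).transpose * (h.1 * mat v.1)).transpose
      = -((h.1 * mat m.1).transpose * (h.1 * mat v.1))
    rw [h1]
    exact v.2⟩
  map_add' v w := Subtype.ext (Prod.ext (Matrix.mul_add h.1 (mat v.1) (mat w.1)) rfl)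
  map_smul' c v := Subtype.ext (Prod.ext (Matrix.mul_smul h.1 c (mat v.1)) rfl)

/-- Left `G`-invariance of a form. -/
def IsLeftInvariant {F : Type} [AddCommGroup F] [Module ℝ F] {k : ℕ} (α : Form F k) : Prop :=
  ∀ (h : Matrix.specialOrthogonalGroup (Fin 3) ℝ) (m : GW),
    (α (leftMul h m)).compLinearMap (leftMulTangent h m) = α m

/-! ### The canonical complex structure -/

/-- The entrywise inclusion of real matrices into complex matrices. -/
def toC (A : Mat) : MatC := A.map Complex.ofReal

/-- The map `(g, x) ↦ g exp (i x X)` into `G^ℂ = SO(3, ℂ)`. Composed with the projection onto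
`G^ℂ / K^ℂ` it is the restriction to `G × W⁺ ≅ T⁺S²` of the inverse of the diffeomorphism
`G^ℂ / K^ℂ → T(G / K)`, `g exp (i w) K^ℂ ↦ d/dt|₀ g exp (t w) K`. -/
def toComplexGroup (m : Amb) : MatC :=
  toC (mat m) * NormedSpace.exp ((Complex.I * (m.2 : ℂ)) • toC X)

/-- The Lie algebra `𝔨^ℂ = ℂ Z` of `K^ℂ = SO(2, ℂ)`. -/
def kC : Submodule ℂ MatC := Submodule.span ℂ {toC Z}

/-- The endomorphism `j` of the tangent space at `m` corresponds to multiplication by `i` on the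
tangent space of `G^ℂ / K^ℂ`. At the coset of `A ∈ G^ℂ` the latter is `A 𝔤^ℂ / A 𝔨^ℂ`, so the
condition is that the differential of `toComplexGroup` intertwines `j` and `i` modulo `A 𝔨^ℂ`. -/
def IsCanonicalComplexStructureAt (m : GW) (j : tangent m.1 →ₗ[ℝ] tangent m.1) : Prop :=
  ∀ v : tangent m.1, ∃ ζ ∈ kC,
    fderiv ℝ toComplexGroup m.1 (j v : Amb)
      - Complex.I • fderiv ℝ toComplexGroup m.1 (v : Amb) = toComplexGroup m.1 * ζ

/-- The explicit value of `exp (i x X)`. -/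
def expIX (x : ℝ) : MatC :=
  !![(Real.cosh x : ℂ), Complex.I * Real.sinh x, 0;
    -(Complex.I * Real.sinh x), (Real.cosh x : ℂ), 0; 0, 0, 1]

lemma hasDerivAt_expIX_apply (x : ℝ) (i j : Fin 3) :
    HasDerivAt (fun y => expIX y i j) ((expIX x * (Complex.I • toC X)) i j) x := by
  have hc : HasDerivAt (fun y : ℝ => ((Real.cosh y : ℝ) : ℂ)) (Real.sinh x : ℝ) x :=
    (Real.hasDerivAt_cosh x).ofReal_comp
  have hs : HasDerivAt (fun y : ℝ => ((Real.sinh y : ℝ) : ℂ)) (Real.cosh x : ℝ) x :=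
    (Real.hasDerivAt_sinh x).ofReal_comp
  have hs' := hs.const_mul Complex.I
  have hI := Complex.I_mul_I
  fin_cases i <;> fin_cases j <;>
    simp [expIX, toC, X, Matrix.mul_apply, Fin.sum_univ_three, -Complex.ofReal_cosh,
      -Complex.ofReal_sinh, mul_comm _ Complex.I]
  · convert hc using 1
    linear_combination -(Real.sinh x : ℂ) * hI
  · exact hs'
  · exact hasDerivAt_const _ _
  · exact hs'.fun_neg
  · convert hc using 1
    linear_combination -(Real.sinh x : ℂ) * hI
  · exact hasDerivAt_const _ _
  · exact hasDerivAt_const _ _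
  · exact hasDerivAt_const _ _
  · exact hasDerivAt_const _ _

lemma eq_exp_of_hasDerivAt {A : Type} [NormedRing A] [NormedAlgebra ℝ A] [CompleteSpace A]
    (R : ℝ → A) (B : A) (h0 : R 0 = 1) (hR : ∀ y, HasDerivAt R (R y * B) y) (x : ℝ) :
    NormedSpace.exp (x • B) = R x := by
  have h : ∀ y : ℝ, HasDerivAt (fun y : ℝ => R y * NormedSpace.exp (y • (-B))) 0 y := by
    intro y
    have h1 := (hR y).mul (hasDerivAt_exp_smul_const' (𝕂 := ℝ) (-B) y)
    have h2 : R y * B * NormedSpace.exp (y • -B) + R y * (-B * NormedSpace.exp (y • -B)) = 0 := by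
      noncomm_ring
    rw [h2] at h1
    exact h1
  have hconst := is_const_of_deriv_eq_zero (fun y => (h y).differentiableAt)
    (fun y => (h y).deriv) x 0
  simp only [zero_smul, NormedSpace.exp_zero, h0, mul_one] at hconst
  let _ : NormedAlgebra ℚ A := NormedAlgebra.restrictScalars ℚ ℝ A
  have hinv : NormedSpace.exp (x • (-B)) * NormedSpace.exp (x • B) = 1 := by
    rw [smul_neg, ← NormedSpace.exp_add_of_commute ((Commute.refl (x • B)).neg_left),
      neg_add_cancel, NormedSpace.exp_zero]
  calc _ = (R x * NormedSpace.exp (x • (-B))) * NormedSpace.exp (x • B) := by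
        rw [hconst, one_mul]
    _ = R x := by rw [mul_assoc, hinv, mul_one]

lemma exp_eq_expIX (x : ℝ) :
    NormedSpace.exp ((Complex.I * (x : ℂ)) • toC X) = expIX x := by
  have hsm : (Complex.I * (x : ℂ)) • toC X = x • (Complex.I • toC X) := by
    rw [mul_comm, mul_smul, Complex.coe_smul]
  have h0 : expIX 0 = 1 := by
    ext i j
    fin_cases i <;> fin_cases j <;> simp [expIX]
  have hd : ∀ y, HasDerivAt (F := Fin 3 → Fin 3 → ℂ) expIX (expIX y * (Complex.I • toC X)) y :=
    fun y => hasDerivAt_pi.2 fun i => hasDerivAt_pi.2 fun j => hasDerivAt_expIX_apply y i j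
  have hcomplete : CompleteSpace (Fin 3 → Fin 3 → ℂ) := inferInstance
  rw [hsm]
  exact @eq_exp_of_hasDerivAt MatC Matrix.linftyOpNormedRing Matrix.linftyOpNormedAlgebra
    hcomplete expIX (Complex.I • toC X) h0 hd x

lemma toC_mul (A B : Mat) : toC (A * B) = toC A * toC B := by
  ext i j
  simp [toC, Matrix.mul_apply]

lemma toComplexGroup_eq (m : Amb) : toComplexGroup m = toC (mat m) * expIX m.2 := by
  rw [toComplexGroup, exp_eq_expIX]

lemma fderiv_toComplexGroup (m v : Amb) :
    fderiv ℝ toComplexGroup m v =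
      toC (mat v) * expIX m.2 + toC (mat m) * (v.2 • (expIX m.2 * (Complex.I • toC X))) := by
  have hentry : ∀ i k, HasFDerivAt (fun n : Amb => ((n.1 i k : ℝ) : ℂ))
      (Complex.ofRealCLM.comp ((ContinuousLinearMap.proj (R := ℝ) k).comp
        ((ContinuousLinearMap.proj (R := ℝ) i).comp
          (ContinuousLinearMap.fst ℝ (Fin 3 → Fin 3 → ℝ) ℝ)))) m := fun i k =>
    (Complex.ofRealCLM.comp ((ContinuousLinearMap.proj (R := ℝ) k).comp
        ((ContinuousLinearMap.proj (R := ℝ) i).comp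
          (ContinuousLinearMap.fst ℝ (Fin 3 → Fin 3 → ℝ) ℝ)))).hasFDerivAt
  have hexp : ∀ k j, HasFDerivAt (fun n : Amb => expIX n.2 k j)
      ((ContinuousLinearMap.toSpanSingleton ℝ ((expIX m.2 * (Complex.I • toC X)) k j)).comp
        (ContinuousLinearMap.snd ℝ (Fin 3 → Fin 3 → ℝ) ℝ)) m := fun k j =>
    (hasDerivAt_expIX_apply m.2 k j).hasFDerivAt.comp m (hasFDerivAt_snd (𝕜 := ℝ))
  have hprod := fun i j => HasFDerivAt.fun_sum (u := Finset.univ)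
    (fun k _ => (hentry i k).mul (hexp k j))
  have hall := hasFDerivAt_pi.2 fun i => hasFDerivAt_pi.2 (hprod i)
  have he : toComplexGroup = fun (n : Amb) (i j : Fin 3) =>
      ∑ k, ((n.1 i k : ℝ) : ℂ) * expIX n.2 k j := by
    funext n i j
    rw [toComplexGroup_eq, Matrix.mul_apply]
    rfl
  have hval := congrArg (fun L => L v) hall.fderiv
  rw [he]
  refine Eq.trans hval ?_
  ext i j
  simp [Matrix.mul_apply, toC, Finset.sum_add_distrib, Fin.sum_univ_three]
  ring

lemma eq_of_skew {ξ : Mat} (h : ξ.transpose = -ξ) :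
    ξ = ξ 0 1 • X + ξ 0 2 • Y + ξ 1 2 • Z := by
  have h' : ∀ i j, ξ j i = -ξ i j := fun i j => congrFun (congrFun h i) j
  have h00 := h' 0 0
  have h11 := h' 1 1
  have h22 := h' 2 2
  have h01 := h' 0 1
  have h02 := h' 0 2
  have h12 := h' 1 2
  ext i j
  fin_cases i <;> fin_cases j <;> simp [X, Y, Z] <;> linarith

lemma transpose_comb (a b c : ℝ) :
    (a • X + b • Y + c • Z).transpose = -(a • X + b • Y + c • Z) := by
  ext i j
  fin_cases i <;> fin_cases j <;> simp [X, Y, Z]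

/-- The endomorphism of the tangent space at `(g, x)` given by `Xˡ ↦ ∂/∂x`, `∂/∂x ↦ -Xˡ`,
`Yˡ ↦ -coth x Zˡ`, `Zˡ ↦ tanh x Yˡ`. -/
def explicitJ (m : GW) : tangent m.1 →ₗ[ℝ] tangent m.1 where
  toFun v := ⟨(Matrix.of.symm (mat m.1 * ((-v.1.2) • X
      + (((mat m.1).transpose * mat v.1) 1 2 * (Real.sinh m.1.2 / Real.cosh m.1.2)) • Y
      + (-(((mat m.1).transpose * mat v.1) 0 2 * (Real.cosh m.1.2 / Real.sinh m.1.2))) • Z)),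
      ((mat m.1).transpose * mat v.1) 0 1), by
    change ((mat m.1).transpose * (mat m.1 * _)).transpose
      = -((mat m.1).transpose * (mat m.1 * _))
    rw [← Matrix.mul_assoc, transpose_mul_self_of_mem m.2.1, Matrix.one_mul]
    exact transpose_comb _ _ _⟩
  map_add' v w := by
    have hs : (mat m.1).transpose * mat (v.1 + w.1)
        = (mat m.1).transpose * mat v.1 + (mat m.1).transpose * mat w.1 :=
      Matrix.mul_add _ (mat v.1) (mat w.1)
    refine Subtype.ext (Prod.ext ?_ ?_)
    · change mat m.1 * _ = mat m.1 * _ + mat m.1 * _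
      rw [← Matrix.mul_add, Submodule.coe_add, hs]
      congr 1
      simp only [Matrix.add_apply, Prod.snd_add]
      module
    · change ((mat m.1).transpose * mat (v.1 + w.1)) 0 1 = _
      rw [hs]
      rfl
  map_smul' c v := by
    have hs : (mat m.1).transpose * mat (c • v.1) = c • ((mat m.1).transpose * mat v.1) :=
      Matrix.mul_smul _ c (mat v.1)
    refine Subtype.ext (Prod.ext ?_ ?_)
    · change mat m.1 * _ = c • (mat m.1 * _)
      rw [← Matrix.mul_smul, Submodule.coe_smul, hs]
      congr 1
      simp only [Matrix.smul_apply, Prod.smul_snd, smul_eq_mul]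
      module
    · change ((mat m.1).transpose * mat (c • v.1)) 0 1 = _
      rw [hs]
      rfl

lemma toC_X : toC X = !![0, 1, 0; -1, 0, 0; 0, 0, 0] := by
  ext i j
  fin_cases i <;> fin_cases j <;> simp [toC, X]

lemma toC_Z : toC Z = !![0, 0, 0; 0, 0, 1; 0, -1, 0] := by
  ext i j
  fin_cases i <;> fin_cases j <;> simp [toC, Z]

lemma toC_comb (a b c : ℝ) : toC (a • X + b • Y + c • Z) =
    !![0, (a : ℂ), (b : ℂ); -(a : ℂ), 0, (c : ℂ); -(b : ℂ), -(c : ℂ), 0] := by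
  ext i j
  fin_cases i <;> fin_cases j <;> simp [toC, X, Y, Z]

lemma tangent_eq (m : GW) (v : tangent m.1) :
    mat v.1 = mat m.1 * (((mat m.1).transpose * mat v.1) 0 1 • X
      + ((mat m.1).transpose * mat v.1) 0 2 • Y + ((mat m.1).transpose * mat v.1) 1 2 • Z) := by
  rw [← eq_of_skew v.2, ← Matrix.mul_assoc, mul_transpose_self_of_mem m.2.1, Matrix.one_mul]

lemma explicitJ_spec (m : GW) : IsCanonicalComplexStructureAt m (explicitJ m) := by
  intro v
  have hx : 0 < m.1.2 := m.2.2
  have hv := tangent_eq m v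
  have hj1 : mat (explicitJ m v).1 = mat m.1 * ((-v.1.2) • X
      + (((mat m.1).transpose * mat v.1) 1 2 * (Real.sinh m.1.2 / Real.cosh m.1.2)) • Y
      + (-(((mat m.1).transpose * mat v.1) 0 2 * (Real.cosh m.1.2 / Real.sinh m.1.2))) • Z) := rfl
  have hj2 : (explicitJ m v).1.2 = ((mat m.1).transpose * mat v.1) 0 1 := rfl
  generalize ((mat m.1).transpose * mat v.1) 0 1 = a at *
  generalize ((mat m.1).transpose * mat v.1) 0 2 = b at *
  generalize ((mat m.1).transpose * mat v.1) 1 2 = c at *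
  have hch : (Real.cosh m.1.2 : ℂ) ≠ 0 := by
    exact_mod_cast (Real.cosh_pos m.1.2).ne'
  have hsh : (Real.sinh m.1.2 : ℂ) ≠ 0 := by
    exact_mod_cast (Real.sinh_pos_iff.2 hx).ne'
  have hcs : (Real.cosh m.1.2 : ℂ) ^ 2 - (Real.sinh m.1.2 : ℂ) ^ 2 = 1 := by
    exact_mod_cast Real.cosh_sq_sub_sinh_sq m.1.2
  refine ⟨(-(b : ℂ) / Real.sinh m.1.2 - Complex.I * c / Real.cosh m.1.2) • toC Z,
    Submodule.smul_mem _ _ (Submodule.subset_span rfl), ?_⟩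
  rw [fderiv_toComplexGroup, fderiv_toComplexGroup, toComplexGroup_eq, hv, hj1, hj2, toC_mul,
    toC_mul]
  simp only [Matrix.mul_assoc, ← Matrix.mul_add, ← Matrix.mul_sub, ← Matrix.mul_smul]
  congr 1
  have hI := Complex.I_sq
  rw [toC_comb, toC_comb, toC_X, toC_Z, expIX]
  simp only [Complex.ofReal_mul, Complex.ofReal_div, Complex.ofReal_neg]
  generalize (Real.cosh m.1.2 : ℂ) = ch at *
  generalize (Real.sinh m.1.2 : ℂ) = sh at *
  generalize Complex.I = im at *
  clear hj1 hj2 hv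
  ext i j
  fin_cases i <;> fin_cases j <;>
    simp [Matrix.mul_apply, Fin.sum_univ_three] <;>
    first
    | ring1
    | grind

theorem existsUnique_canonicalComplexStructureAt (m : GW) :
    ∃! j, IsCanonicalComplexStructureAt m j := by
  refine ⟨explicitJ m, explicitJ_spec m, fun j' hj' => ?_⟩
  ext1 v
  obtain ⟨ζ, hζ, h1⟩ := hj' v
  obtain ⟨ζ', hζ', h2⟩ := explicitJ_spec m v
  rw [← sub_eq_zero]
  set d := j' v - explicitJ m v with hd
  obtain ⟨z, hz⟩ := Submodule.mem_span_singleton.1 (Submodule.sub_mem _ hζ hζ')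
  have h3 : fderiv ℝ toComplexGroup m.1 d.1 = toComplexGroup m.1 * (z • toC Z) := by
    rw [hz, Matrix.mul_sub, ← h1, ← h2, hd, Submodule.coe_sub, map_sub]
    abel
  have hv := tangent_eq m d
  rw [fderiv_toComplexGroup, toComplexGroup_eq, hv, toC_mul] at h3
  simp only [Matrix.mul_assoc, ← Matrix.mul_add] at h3
  have hg : toC (mat m.1).transpose * toC (mat m.1) = 1 := by
    rw [← toC_mul, transpose_mul_self_of_mem m.2.1]
    ext i j
    simp [toC, Matrix.one_apply, apply_ite]
  have h4 := congrArg (fun A => toC (mat m.1).transpose * A) h3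
  simp only [← Matrix.mul_assoc (toC (mat m.1).transpose), hg, Matrix.one_mul] at h4
  rw [toC_comb, toC_X, toC_Z, expIX] at h4
  have hx : 0 < m.1.2 := m.2.2
  have hch := (Real.cosh_pos m.1.2).ne'
  generalize ((mat m.1).transpose * mat d.1) 0 1 = a at *
  generalize ((mat m.1).transpose * mat d.1) 0 2 = b at *
  generalize ((mat m.1).transpose * mat d.1) 1 2 = c at *
  generalize Real.cosh m.1.2 = ch at *
  have hsh := (Real.sinh_pos_iff.2 hx).ne'
  generalize Real.sinh m.1.2 = sh at *
  have e1 := congrFun (congrFun h4 1) 0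
  have e2 := congrFun (congrFun h4 2) 0
  simp [Matrix.mul_apply, Fin.sum_univ_three] at e1 e2
  have r1 := congrArg Complex.re e1
  have i1 := congrArg Complex.im e1
  have r2 := congrArg Complex.re e2
  have i2 := congrArg Complex.im e2
  simp [hch, hsh] at r1 i1 r2 i2
  refine Subtype.ext (Prod.ext ?_ ?_)
  · change mat d.1 = (0 : Mat)
    rw [hv, r1, r2, i2]
    simp
  · exact i1


/-- The canonical complex structure `J_c` on `G × W⁺`, pulled back from `G^ℂ / K^ℂ`. -/
def Jc (m : GW) : tangent m.1 →ₗ[ℝ] tangent m.1 :=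
  (existsUnique_canonicalComplexStructureAt m).choose

lemma Jc_spec (m : GW) : IsCanonicalComplexStructureAt m (Jc m) :=
  (existsUnique_canonicalComplexStructureAt m).choose_spec.1

/-! ### Kähler structures and potentials -/

/-- The `2`-form `ω` determines a `G`-invariant Kähler structure associated to `J_c`: it is
smooth, closed, `G`-invariant and `J_c`-invariant, and `g(u, v) = ω(J_c u, v)` is
positive-definite (symmetry of `g` follows from the `J_c`-invariance of `ω`). -/
structure IsInvariantKahler (ω : Form ℝ 2) : Prop where
  smooth : IsSmoothForm ω
  closed : IsExtDeriv ω (fun _ => 0)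
  invariant : IsLeftInvariant ω
  compatible : ∀ (m : GW) (u v : tangent m.1), ω m ![Jc m u, Jc m v] = ω m ![u, v]
  positive : ∀ (m : GW) (u : tangent m.1), u ≠ 0 → 0 < ω m ![Jc m u, u]

lemma form_one_add (D : Form ℝ 1) (m : GW) (a b : tangent m.1) :
    D m ![a + b] = D m ![a] + D m ![b] := by
  have h := (D m).map_update_add ![a] 0 a b
  have hu : ∀ c : tangent m.1, Function.update ![a] 0 c = ![c] := fun c => by
    ext1 i
    fin_cases i
    rfl
  rwa [hu, hu, hu] at h

lemma form_one_smul (D : Form ℝ 1) (m : GW) (c : ℝ) (a : tangent m.1) :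
    D m ![c • a] = c * D m ![a] := by
  have h := (D m).map_update_smul ![a] 0 c a
  have hu : ∀ c : tangent m.1, Function.update ![a] 0 c = ![c] := fun c => by
    ext1 i
    fin_cases i
    rfl
  rwa [hu, hu] at h

/-- The `(1,0)`-part `∂Q = ½ (dQ - i dQ ∘ J_c)` of a real `1`-form `dQ`. -/
def partOneZero (D : Form ℝ 1) : Form ℂ 1 := fun m =>
  AlternatingMap.ofSubsingleton ℝ _ _ 0
    { toFun := fun u => ((D m ![u] : ℂ) - Complex.I * (D m ![Jc m u] : ℂ)) / 2
      map_add' := by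
        intro u v
        rw [map_add, form_one_add, form_one_add]
        push_cast
        ring
      map_smul' := by
        intro c u
        rw [map_smul, form_one_smul, form_one_smul]
        simp only [Complex.real_smul, RingHom.id_apply]
        push_cast
        ring }

/-- `Q` is a potential function of the Kähler structure `(ω, J_c)`: `ω = i ∂̄∂Q`, where `∂̄∂Q`
is the `(1,1)`-part of `β = d(∂Q)`. (The sign goes with the convention `g(u, v) = ω(J_c u, v)`.) -/
def IsKahlerPotential (Q : GW → ℝ) (ω : Form ℝ 2) : Prop :=
  ∃ (D : Form ℝ 1) (β : Form ℂ 2), IsExtDeriv (zeroForm Q) D ∧ IsExtDeriv (partOneZero D) β ∧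
    ∀ (m : GW) (u v : tangent m.1),
      (ω m ![u, v] : ℂ) = Complex.I * ((β m ![u, v] + β m ![Jc m u, Jc m v]) / 2)

/-! ### Vector-functions on `W⁺` -/

/-- `a(x) = f'(x) X + (c_Z / cosh x) Z + (c_Y / sinh x) Y`. -/
def vectorFunction (f : ℝ → ℝ) (cZ cY : ℝ) (x : ℝ) : Mat :=
  deriv f x • X + (cZ / Real.cosh x) • Z + (cY / Real.sinh x) • Y

/-- `f ∈ C^∞(ℝ⁺)` and the two inequalities hold on `ℝ⁺`. -/
structure IsAdmissible (f : ℝ → ℝ) (cZ cY : ℝ) : Prop where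
  smooth : ContDiffOn ℝ (⊤ : ℕ∞) f (Set.Ioi 0)
  pos : ∀ x : ℝ, 0 < x → 0 < deriv (deriv f) x
  det_pos : ∀ x : ℝ, 0 < x →
    0 < deriv (deriv f) x * deriv f x / (Real.cosh x * Real.sinh x)
      - cZ ^ 2 / Real.cosh x ^ 4 - cY ^ 2 / Real.sinh x ^ 4

/-! ### The punctured tangent bundle of the sphere -/

/-- `T⁺S²` as a submanifold of `ℝ³ × ℝ³`: the pairs `(p, v)` with `|p| = 1`, `v ⟂ p`, `v ≠ 0`. -/
def TplusS2 : Set ((Fin 3 → ℝ) × (Fin 3 → ℝ)) :=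
  {q | q.1 ⬝ᵥ q.1 = 1 ∧ q.1 ⬝ᵥ q.2 = 0 ∧ q.2 ≠ 0}

/-- The first vector of the standard basis of `ℝ³`, whose stabilizer in `SO(3)` is `K`; the
sphere is identified with `G / K` by `g K ↦ g e₁`. -/
def e₁ : Fin 3 → ℝ := Pi.single 0 1

/-- The map `(g, x) ↦ d/dt|₀ g exp (t x X) K ∈ T(G / K) = TS²`. -/
def toTS2 (m : Amb) : (Fin 3 → ℝ) × (Fin 3 → ℝ) :=
  ((mat m).mulVec e₁, deriv (fun t : ℝ => (mat m * NormedSpace.exp ((t * m.2) • X)).mulVec e₁) 0)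

/-- `Φ` is an `SO(3)`-equivariant diffeomorphism of `G × W⁺` onto `T⁺S²`: an equivariant bijection
that is smooth and whose inverse is the restriction of a smooth map on a neighbourhood of `T⁺S²`. -/
structure IsEquivariantDiffeo (Φ : Amb → (Fin 3 → ℝ) × (Fin 3 → ℝ)) : Prop where
  bijOn : Set.BijOn Φ GW TplusS2
  equivariant : ∀ h ∈ Matrix.specialOrthogonalGroup (Fin 3) ℝ, ∀ m ∈ GW,
    Φ (Matrix.of.symm (h * mat m), m.2) = (h.mulVec (Φ m).1, h.mulVec (Φ m).2)
  smooth : ContDiff ℝ (⊤ : ℕ∞) Φ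
  smooth_inverse : ∃ (V : Set ((Fin 3 → ℝ) × (Fin 3 → ℝ)))
    (Ψ : (Fin 3 → ℝ) × (Fin 3 → ℝ) → Amb),
    IsOpen V ∧ TplusS2 ⊆ V ∧ ContDiffOn ℝ (⊤ : ℕ∞) Ψ V ∧ ∀ m ∈ GW, Ψ (Φ m) = m

end PuncturedTS2

end

noncomputable section

namespace PuncturedTS2

open Topology VectorField

/-! ### One-parameter subgroups -/

/-! Everything is computed in the left-invariant frame `X, Y, Z, ∂/∂x`. Since `G` acts simply
transitively on the first factor, a form is invariant exactly when its coefficients in this frame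
depend on `x` alone. On such forms the exterior derivative becomes Cartan's formula: `d/dx` in the
`∂/∂x` slots and the brackets `[X,Y] = -Z`, `[X,Z] = Y`, `[Y,Z] = -X` elsewhere
(`extDeriv_leftField`). The complex structure becomes `X ↦ ∂/∂x`, `Y ↦ -coth x Z`, `Z ↦ tanh x Y`
(`Jc_frame`). The Kähler conditions are thus conditions on six functions of `x`.

Necessity. Contracting `dω = 0` with `∂/∂x` gives `ω(u,v)' = ω([u,v], ∂/∂x)` for `u, v` in `so(3)`
(`HasCoeffs.closed`), and `J_c`-invariance ties `ω(Y,∂/∂x)`, `ω(Z,∂/∂x)` to `ω(X,Z)`, `ω(X,Y)`.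
Together they yield `ω(X,Y)' = -tanh x · ω(X,Y)` and `ω(X,Z)' = -coth x · ω(X,Z)`, solved by
constants over `cosh` and `sinh`. The function `ω(Y,Z)` remains free; it is `f'`, and then
`ω(X,∂/∂x) = -f''`. These are precisely the coefficients of `dθ̃ᵃ`.

Positivity. Multiplied by `f'`, the quadratic form `ω(J_c u, u)` is a sum of two squares plus the
determinant expression of the second inequality times a nonnegative form in the `X` and `∂/∂x`
coordinates (`dOneCoeffs_theta_coordJ_self`). This gives both directions: the two inequalities imply
`f' > 0` and positivity, and suitable test vectors recover them.

Potential. For `Q = 2f`, `∂Q = f' dx - i θ̃ᵃ` with `a = f' X`; the first term is closed, so `d∂Q =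
-iω`, which is already of type `(1,1)`. -/

lemma hasDerivAt_exp_smul_matrix (B : Mat) (t : ℝ) :
    HasDerivAt (F := Fin 3 → Fin 3 → ℝ)
      (fun u : ℝ => Matrix.of.symm (NormedSpace.exp (u • B)))
      (Matrix.of.symm (NormedSpace.exp (t • B) * B)) t := by
  have hcomplete : CompleteSpace (Fin 3 → Fin 3 → ℝ) := inferInstance
  -- The derivative of `exp` is a fact about Banach algebras, so an operator norm is supplied by
  -- hand; the statement itself is in the space of arrays.
  exact @hasDerivAt_exp_smul_const ℝ Mat _ Matrix.linftyOpNormedRing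
    Matrix.linftyOpNormedAlgebra hcomplete B t

lemma hasDerivAt_mul_exp_smul (g B : Mat) (t : ℝ) :
    HasDerivAt (F := Fin 3 → Fin 3 → ℝ)
      (fun u : ℝ => Matrix.of.symm (g * NormedSpace.exp (u • B)))
      (Matrix.of.symm (g * (NormedSpace.exp (t • B) * B))) t := by
  have h := fun i j => hasDerivAt_pi.1 (hasDerivAt_pi.1 (hasDerivAt_exp_smul_matrix B t) i) j
  refine hasDerivAt_pi.2 fun i => hasDerivAt_pi.2 fun j => ?_
  exact HasDerivAt.fun_sum (u := Finset.univ) fun k _ => (h k j).const_mul (g i k)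

lemma exp_mem_specialOrthogonalGroup {B : Mat} (hB : B.transpose = -B) :
    NormedSpace.exp B ∈ Matrix.specialOrthogonalGroup (Fin 3) ℝ := by
  have hinv : NormedSpace.exp B * NormedSpace.exp (-B) = 1 := by
    rw [← Matrix.exp_add_of_commute _ _ (Commute.refl B).neg_right, add_neg_cancel,
      NormedSpace.exp_zero]
  have horth : NormedSpace.exp B * (NormedSpace.exp B).transpose = 1 := by
    rw [← Matrix.exp_transpose, hB, hinv]
  -- Orthogonality gives only `det ^ 2 = 1`. Being the square of `exp (B / 2)`, the matrix has
  -- nonnegative determinant, which excludes `-1`.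
  have hsq : NormedSpace.exp B
      = NormedSpace.exp ((1 / 2 : ℝ) • B) * NormedSpace.exp ((1 / 2 : ℝ) • B) := by
    rw [← Matrix.exp_add_of_commute _ _ (Commute.refl _), ← add_smul]
    norm_num
  have hdet := congrArg Matrix.det horth
  rw [Matrix.det_mul, Matrix.det_transpose, Matrix.det_one] at hdet
  have hnonneg : 0 ≤ (NormedSpace.exp B).det := by
    rw [hsq, Matrix.det_mul]
    exact mul_self_nonneg _
  refine Matrix.mem_specialOrthogonalGroup_iff.2 ⟨?_, by nlinarith⟩
  rw [Matrix.mem_orthogonalGroup_iff]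
  simpa [Matrix.star_eq_conjTranspose] using horth

/-! ### The left-invariant frame -/

/-- Coordinates on `𝔤 × ℝ` in the basis `X, Y, Z, ∂/∂x`. -/
abbrev Coord := Fin 4 → ℝ

/-- The component in `so(3)` of an element of `𝔤 × ℝ`. -/
def skew (w : Coord) : Mat := w 0 • X + w 1 • Y + w 2 • Z

lemma skew_transpose (w : Coord) : (skew w).transpose = -skew w := transpose_comb _ _ _

/-- The linear part of `leftField`. -/
def leftFieldLinear (w : Coord) : Amb →L[ℝ] Amb :=
  LinearMap.toContinuousLinearMap
    { toFun := fun m => (Matrix.of.symm (mat m * skew w), 0)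
      map_add' := fun m n => Prod.ext (Matrix.add_mul (mat m) (mat n) (skew w)) (by simp)
      map_smul' := fun c m => Prod.ext (Matrix.smul_mul c (mat m) (skew w)) (by simp) }

/-- The vector field `(g, x) ↦ (g ξ, t)` on the ambient space, for `(ξ, t) ∈ 𝔤 × ℝ`. -/
def leftField (w : Coord) (m : Amb) : Amb := leftFieldLinear w m + (0, w 3)

lemma leftField_fst (w : Coord) (m : Amb) : mat (leftField w m) = mat m * skew w :=
  add_zero (mat m * skew w)

lemma leftField_snd (w : Coord) (m : Amb) : (leftField w m).2 = w 3 :=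
  zero_add (w 3)

lemma hasFDerivAt_leftField (w : Coord) (m : Amb) :
    HasFDerivAt (leftField w) (leftFieldLinear w) m :=
  (leftFieldLinear w).hasFDerivAt.add_const _

/-- The Lie bracket of `𝔤 × ℝ` in coordinates. -/
def bracket (w w' : Coord) : Coord :=
  ![-(w 1 * w' 2 - w 2 * w' 1), w 0 * w' 2 - w 2 * w' 0, -(w 0 * w' 1 - w 1 * w' 0), 0]

lemma skew_bracket (w w' : Coord) :
    skew (bracket w w') = skew w * skew w' - skew w' * skew w := by
  ext i j
  fin_cases i <;> fin_cases j <;>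
    simp [skew, bracket, X, Y, Z] <;> ring

/-- The fields are affine in the matrix entries, so the bracket is that of right multiplications on
the whole ambient space: `m (A B - B A)`, with no restriction to the group needed. The constant
`∂/∂x` parts contribute nothing. -/
lemma lieBracket_leftField (w w' : Coord) (m : Amb) :
    lieBracket ℝ (leftField w) (leftField w') m = leftField (bracket w w') m := by
  rw [lieBracket, (hasFDerivAt_leftField w m).fderiv, (hasFDerivAt_leftField w' m).fderiv]
  refine Prod.ext ?_ ?_
  · change mat (leftField w m) * skew w' - mat (leftField w' m) * skew w
      = mat (leftField (bracket w w') m)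
    rw [leftField_fst, leftField_fst, leftField_fst, skew_bracket, Matrix.mul_sub,
      Matrix.mul_assoc, Matrix.mul_assoc]
  · rw [leftField_snd]
    change (0 : ℝ) - 0 = _
    simp [bracket]

lemma leftField_mem_tangent (w : Coord) (m : GW) : leftField w m.1 ∈ tangent m.1 := by
  change ((mat m.1).transpose * mat (leftField w m.1)).transpose
    = -((mat m.1).transpose * mat (leftField w m.1))
  rw [leftField_fst, ← Matrix.mul_assoc, transpose_mul_self_of_mem m.2.1, Matrix.one_mul,
    skew_transpose]

/-- The tangent vector `(g ξ, t)` at `(g, x)`. -/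
def frame (m : GW) (w : Coord) : tangent m.1 := ⟨leftField w m.1, leftField_mem_tangent w m⟩

/-- The coordinates of a tangent vector in the left-invariant frame. -/
def coord (m : GW) (v : tangent m.1) : Coord :=
  ![((mat m.1).transpose * mat v.1) 0 1, ((mat m.1).transpose * mat v.1) 0 2,
    ((mat m.1).transpose * mat v.1) 1 2, v.1.2]

lemma transpose_mul_frame (m : GW) (w : Coord) :
    (mat m.1).transpose * mat (frame m w).1 = skew w := by
  rw [frame, leftField_fst, ← Matrix.mul_assoc, transpose_mul_self_of_mem m.2.1, Matrix.one_mul]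

lemma frame_snd (m : GW) (w : Coord) : (frame m w).1.2 = w 3 := leftField_snd w m.1

lemma frame_coord (m : GW) (v : tangent m.1) : frame m (coord m v) = v := by
  refine Subtype.ext (Prod.ext ?_ (frame_snd _ _))
  change mat (leftField (coord m v) m.1) = mat v.1
  rw [leftField_fst, tangent_eq m v]
  simp [skew, coord]

lemma coord_frame (m : GW) (w : Coord) : coord m (frame m w) = w := by
  have h := transpose_mul_frame m w
  ext i
  rw [coord, h, frame_snd]
  fin_cases i <;> simp [skew, X, Y, Z]

lemma leftMulTangent_frame (h : Matrix.specialOrthogonalGroup (Fin 3) ℝ) (m : GW) (w : Coord) :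
    leftMulTangent h m (frame m w) = frame (leftMul h m) w := by
  refine Subtype.ext (Prod.ext ?_ ?_)
  · change h.1 * mat (leftField w m.1) = mat (leftField w (leftMul h m).1)
    rw [leftField_fst, leftField_fst, ← Matrix.mul_assoc]
    rfl
  · change (leftField w m.1).2 = (leftField w (leftMul h m).1).2
    rw [leftField_snd, leftField_snd]

/-- The canonical complex structure in coordinates. -/
def coordJ (x : ℝ) (w : Coord) : Coord :=
  ![-w 3, w 2 * (Real.sinh x / Real.cosh x), -(w 1 * (Real.cosh x / Real.sinh x)), w 0]

lemma Jc_eq_explicitJ (m : GW) : Jc m = explicitJ m :=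
  (existsUnique_canonicalComplexStructureAt m).unique (Jc_spec m) (explicitJ_spec m)

lemma Jc_frame (m : GW) (w : Coord) : Jc m (frame m w) = frame m (coordJ m.1.2 w) := by
  have h := transpose_mul_frame m w
  rw [Jc_eq_explicitJ]
  refine Subtype.ext (Prod.ext ?_ ?_)
  · change mat m.1 * _ = mat (leftField (coordJ m.1.2 w) m.1)
    rw [leftField_fst, h, frame_snd]
    congr 1
    simp [skew, coordJ, X, Y, Z]
  · rw [frame_snd]
    change ((mat m.1).transpose * mat (frame m w).1) 0 1 = _
    rw [h]
    simp [skew, coordJ, X, Y, Z]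

/-- The point `(1, x)`. -/
def basePoint (x : ℝ) (hx : 0 < x) : GW :=
  ⟨(Matrix.of.symm 1, x), one_mem (Matrix.specialOrthogonalGroup (Fin 3) ℝ), hx⟩

lemma exists_leftMul_basePoint (m : GW) :
    ∃ h, leftMul h (basePoint m.1.2 m.2.2) = m :=
  ⟨⟨mat m.1, m.2.1⟩, Subtype.ext (Prod.ext (Matrix.mul_one (mat m.1)) rfl)⟩

/-! ### The exterior derivative of a left-invariant form -/

section Cartan

variable {F : Type} [NormedAddCommGroup F] [NormedSpace ℝ F] {k : ℕ}

/-- The form `α` has the coefficients `A`, which depend on `x` only, in the left-invariant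
frame. -/
def HasCoeffs (α : Form F k) (A : (Fin k → Coord) → ℝ → F) : Prop :=
  ∀ (m : GW) (w : Fin k → Coord), α m (fun i => frame m (w i)) = A w m.1.2

/-- The curve `t ↦ (g exp (t ξ), x + t s)`. -/
def flow (m : Amb) (w : Coord) (t : ℝ) : Amb :=
  (Matrix.of.symm (mat m * NormedSpace.exp (t • skew w)), m.2 + w 3 * t)

lemma flow_zero (m : Amb) (w : Coord) : flow m w 0 = m := by
  refine Prod.ext ?_ (by simp [flow])
  change mat m * NormedSpace.exp ((0 : ℝ) • skew w) = mat m
  rw [zero_smul, NormedSpace.exp_zero, Matrix.mul_one]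

lemma hasDerivAt_flow (m : Amb) (w : Coord) : HasDerivAt (flow m w) (leftField w m) 0 := by
  have h1 := hasDerivAt_mul_exp_smul (mat m) (skew w) 0
  rw [zero_smul, NormedSpace.exp_zero, Matrix.one_mul] at h1
  have h2 : HasDerivAt (fun t => m.2 + w 3 * t) (w 3) 0 := by
    simpa using ((hasDerivAt_id (0 : ℝ)).const_mul (w 3)).const_add m.2
  have h3 := h1.prodMk h2
  have h4 : leftField w m = (Matrix.of.symm (mat m * skew w), w 3) :=
    Prod.ext (leftField_fst w m) (leftField_snd w m)
  rw [h4]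
  exact h3

lemma flow_mem {m : Amb} (hm : m ∈ GW) (w : Coord) {t : ℝ} (ht : 0 < m.2 + w 3 * t) :
    flow m w t ∈ GW := by
  refine ⟨mul_mem hm.1 (exp_mem_specialOrthogonalGroup ?_), ht⟩
  rw [Matrix.transpose_smul, skew_transpose, smul_neg]

/-- The extension `η` agrees with `α` on `G × W⁺` only, but its derivative in a tangent direction
can be taken along the curve `flow`, which stays in `G × W⁺` for small times. There `η` evaluates to
`A w (x + s t)`, so the choice of `η` plays no role. -/
lemma fderiv_apply_leftField {α : Form F k} {A : (Fin k → Coord) → ℝ → F} (hA : HasCoeffs α A)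
    {U : Set Amb} (hU : IsOpen U) {η : Amb → Amb [⋀^Fin k]→L[ℝ] F}
    (hη : IsSmoothExtension α U η) (m : GW) (hm : m.1 ∈ U) (w : Fin k → Coord) (u : Coord) :
    fderiv ℝ (fun n => η n (fun i => leftField (w i) n)) m.1 (leftField u m.1)
      = u 3 • deriv (A w) m.1.2 := by
  have hd : DifferentiableAt ℝ η m.1 :=
    ((hη.1.contDiffAt (hU.mem_nhds hm)).differentiableAt (by simp))
  have hG : DifferentiableAt ℝ (fun n => η n (fun i => leftField (w i) n)) m.1 := by
    exact (hd.hasFDerivAt.continuousAlternatingMap_apply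
      fun i => hasFDerivAt_leftField (w i) m.1).differentiableAt
  have hγ := hasDerivAt_flow m.1 u
  have hG' : HasFDerivAt (fun n => η n (fun i => leftField (w i) n))
      (fderiv ℝ (fun n => η n (fun i => leftField (w i) n)) m.1) (flow m.1 u 0) := by
    rw [flow_zero]; exact hG.hasFDerivAt
  have h1 := hG'.comp_hasDerivAt (0 : ℝ) hγ
  have hev : ∀ᶠ t in 𝓝 (0 : ℝ), flow m.1 u t ∈ U ∧ 0 < m.1.2 + u 3 * t := by
    refine Filter.Eventually.and ?_ ?_
    · refine hγ.continuousAt.eventually_mem (hU.mem_nhds ?_)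
      rwa [flow_zero]
    · have hc : ContinuousAt (fun t : ℝ => m.1.2 + u 3 * t) 0 := by fun_prop
      refine hc.eventually (lt_mem_nhds ?_)
      simpa using m.2.2
  have h2 : (fun t => A w (m.1.2 + u 3 * t)) =ᶠ[𝓝 0]
      ((fun n => η n (fun i => leftField (w i) n)) ∘ flow m.1 u) := by
    filter_upwards [hev] with t ht
    exact ((hη.2 ⟨_, flow_mem m.2 u ht.2⟩ ht.1
      (fun i => frame ⟨_, flow_mem m.2 u ht.2⟩ (w i))).trans
        (hA ⟨_, flow_mem m.2 u ht.2⟩ w)).symm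
  rw [← h1.deriv, ← h2.deriv_eq]
  -- This rescaling rule holds for `deriv` of arbitrary functions, so no differentiability of `A w`
  -- is needed, and `u 3 = 0` is covered.
  have h3 := deriv_comp_mul_left (u 3) (fun s => A w (m.1.2 + s)) 0
  rw [h3, deriv_comp_const_add]
  simp

/-- Cartan's formula for `dη` on the ambient fields `leftField`: their brackets are fields of the
same kind, so every term depends only on the coefficients of `α`. -/
theorem extDeriv_leftField {α : Form F (k + 1)} {A : (Fin (k + 1) → Coord) → ℝ → F}
    (hA : HasCoeffs α A) {U : Set Amb} (hU : IsOpen U)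
    {η : Amb → Amb [⋀^Fin (k + 1)]→L[ℝ] F}
    (hη : IsSmoothExtension α U η) (m : GW) (hm : m.1 ∈ U) (w : Fin (k + 2) → Coord) :
    extDeriv η m.1 (fun i => leftField (w i) m.1)
      = (∑ i, (-1) ^ i.val • (w i 3 • deriv (A (i.removeNth w)) m.1.2))
        - ∑ i : Fin (k + 1), ∑ j ≥ i, (-1) ^ (i + j : ℕ) •
          A (Matrix.vecCons (bracket (w i.castSucc) (w j.succ))
            (j.removeNth (i.castSucc.removeNth w))) m.1.2 := by
  have hd : DifferentiableAt ℝ η m.1 :=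
    ((hη.1.contDiffAt (hU.mem_nhds hm)).differentiableAt (by simp))
  rw [extDeriv_apply_vectorField (V := fun i => leftField (w i)) hd
    fun i => (hasFDerivAt_leftField _ _).differentiableAt]
  congr 1
  · refine Finset.sum_congr rfl fun i _ => ?_
    congr 1
    exact fderiv_apply_leftField hA hU hη m hm (i.removeNth w) (w i)
  · refine Finset.sum_congr rfl fun i _ => Finset.sum_congr rfl fun j _ => ?_
    congr 1
    rw [← hA m, ← hη.2 m hm]
    congr 1
    ext1 l
    refine Fin.cases ?_ (fun l => ?_) l
    · exact lieBracket_leftField _ _ _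
    · rfl

theorem extDeriv_leftField_one {α : Form F 1} {A : (Fin 1 → Coord) → ℝ → F}
    (hA : HasCoeffs α A) {U : Set Amb} (hU : IsOpen U) {η : Amb → Amb [⋀^Fin 1]→L[ℝ] F}
    (hη : IsSmoothExtension α U η) (m : GW) (hm : m.1 ∈ U) (w : Fin 2 → Coord) :
    extDeriv η m.1 (fun i => leftField (w i) m.1)
      = w 0 3 • deriv (A ![w 1]) m.1.2 - w 1 3 • deriv (A ![w 0]) m.1.2
        - A ![bracket (w 0) (w 1)] m.1.2 := by
  have e0 : Fin.removeNth 0 w = ![w 1] := by ext1 i; fin_cases i; rfl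
  have e1 : Fin.removeNth 1 w = ![w 0] := by ext1 i; fin_cases i; rfl
  have hs : Finset.Ici (0 : Fin 1) = {0} := rfl
  rw [extDeriv_leftField hA hU hη m hm]
  simp [Fin.sum_univ_two, e0, e1, hs, sub_eq_add_neg]

theorem extDeriv_leftField_two {α : Form F 2} {A : (Fin 2 → Coord) → ℝ → F}
    (hA : HasCoeffs α A) {U : Set Amb} (hU : IsOpen U) {η : Amb → Amb [⋀^Fin 2]→L[ℝ] F}
    (hη : IsSmoothExtension α U η) (m : GW) (hm : m.1 ∈ U) (w : Fin 3 → Coord) :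
    extDeriv η m.1 (fun i => leftField (w i) m.1)
      = w 0 3 • deriv (A ![w 1, w 2]) m.1.2 - w 1 3 • deriv (A ![w 0, w 2]) m.1.2
        + w 2 3 • deriv (A ![w 0, w 1]) m.1.2
        - A ![bracket (w 0) (w 1), w 2] m.1.2 + A ![bracket (w 0) (w 2), w 1] m.1.2
        - A ![bracket (w 1) (w 2), w 0] m.1.2 := by
  have e0 : Fin.removeNth 0 w = ![w 1, w 2] := by ext1 i; fin_cases i <;> rfl
  have e1 : Fin.removeNth 1 w = ![w 0, w 2] := by ext1 i; fin_cases i <;> rfl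
  have e2 : Fin.removeNth 2 w = ![w 0, w 1] := by ext1 i; fin_cases i <;> rfl
  have f0 : Matrix.vecCons (bracket (w 0) (w 1))
      (Fin.removeNth 0 (Fin.removeNth 0 w)) = ![bracket (w 0) (w 1), w 2] := by
    ext1 i; fin_cases i <;> rfl
  have f1 : Matrix.vecCons (bracket (w 0) (w 2))
      (Fin.removeNth 1 (Fin.removeNth 0 w)) = ![bracket (w 0) (w 2), w 1] := by
    ext1 i; fin_cases i <;> rfl
  have f2 : Matrix.vecCons (bracket (w 1) (w 2))
      (Fin.removeNth 1 (Fin.removeNth 1 w)) = ![bracket (w 1) (w 2), w 0] := by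
    ext1 i; fin_cases i <;> rfl
  have hs0 : Finset.Ici (0 : Fin 2) = {0, 1} := rfl
  have hs1 : Finset.Ici (1 : Fin 2) = {1} := rfl
  have c0 : Fin.castSucc (0 : Fin 2) = 0 := rfl
  have c1 : Fin.castSucc (1 : Fin 2) = 1 := rfl
  have d0 : Fin.succ (0 : Fin 2) = 1 := rfl
  have d1 : Fin.succ (1 : Fin 2) = 2 := rfl
  rw [extDeriv_leftField hA hU hη m hm, Fin.sum_univ_three, Fin.sum_univ_two, hs0, hs1,
    Finset.sum_pair (by decide), Finset.sum_singleton, c0, c1, d0, d1, f0, f1, f2, e0, e1, e2]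
  simp only [Fin.val_zero, Fin.val_one, Fin.val_two, pow_zero, pow_one, one_smul, neg_smul,
    zero_add, add_zero, Nat.reduceAdd, even_two, Even.neg_pow, one_pow]
  abel

end Cartan

/-! ### The identification of `G × W⁺` with `T⁺S²` -/

lemma mulVec_e₁ (A : Mat) : A.mulVec e₁ = fun i => A i 0 := by
  ext i
  simp [e₁]

/-- Since `X e₁ = -e₂`, the velocity at `t = 0` is `-x g e₂`. Hence `x` is the length of the tangent
vector and the first two columns of `g` can be read off from its image. -/
lemma toTS2_eq (m : Amb) : toTS2 m = (fun i => m.1 i 0, fun i => -(m.2 * m.1 i 1)) := by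
  refine Prod.ext (mulVec_e₁ _) ?_
  have h := hasDerivAt_mul_exp_smul (mat m) (m.2 • X) 0
  rw [zero_smul, NormedSpace.exp_zero, Matrix.one_mul] at h
  have h' : HasDerivAt (fun t : ℝ => (mat m * NormedSpace.exp ((t * m.2) • X)).mulVec e₁)
      (fun i => (mat m * (m.2 • X)) i 0) 0 := by
    refine hasDerivAt_pi.2 fun i => ?_
    simp only [mulVec_e₁, mul_smul]
    exact hasDerivAt_pi.1 (hasDerivAt_pi.1 h i) 0
  change deriv _ 0 = _
  rw [h'.deriv]
  ext i
  simp [X, Matrix.mul_apply, Fin.sum_univ_three, mul_comm]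

lemma toTS2_equivariant (h : Mat) (m : Amb) :
    toTS2 (Matrix.of.symm (h * mat m), m.2)
      = (h.mulVec (toTS2 m).1, h.mulVec (toTS2 m).2) := by
  rw [toTS2_eq, toTS2_eq]
  refine Prod.ext ?_ ?_
  · ext i
    simp [Matrix.mul_apply, Matrix.mulVec, dotProduct]
  · ext i
    simp [Matrix.mul_apply, Matrix.mulVec, dotProduct, Fin.sum_univ_three]
    ring

lemma contDiff_toTS2 {n : WithTop ℕ∞} : ContDiff ℝ n toTS2 := by
  have h : toTS2 = fun m => (fun i => m.1 i 0, fun i => -(m.2 * m.1 i 1)) := funext toTS2_eq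
  rw [h]
  fun_prop

/-- The length of a vector of `ℝ³`. -/
def length (v : Fin 3 → ℝ) : ℝ := √(v ⬝ᵥ v)

lemma dotProduct_self_nonneg (v : Fin 3 → ℝ) : 0 ≤ v ⬝ᵥ v :=
  Finset.sum_nonneg fun _ _ => mul_self_nonneg _

lemma length_nonneg (v : Fin 3 → ℝ) : 0 ≤ length v := Real.sqrt_nonneg _

lemma length_pos {v : Fin 3 → ℝ} (hv : v ≠ 0) : 0 < length v :=
  Real.sqrt_pos.2 (lt_of_le_of_ne (dotProduct_self_nonneg v)
    fun h => hv (dotProduct_self_eq_zero.1 h.symm))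

lemma length_sq (v : Fin 3 → ℝ) : length v ^ 2 = v ⬝ᵥ v :=
  Real.sq_sqrt (dotProduct_self_nonneg v)

/-- The matrix with the columns `p`, `u`, `p × u`. -/
def orthoMatrix (p u : Fin 3 → ℝ) : Mat :=
  Matrix.of ![p, u, ![p 1 * u 2 - p 2 * u 1, p 2 * u 0 - p 0 * u 2, p 0 * u 1 - p 1 * u 0]]
    |>.transpose

lemma orthoMatrix_mem {p u : Fin 3 → ℝ} (hp : p ⬝ᵥ p = 1) (hu : u ⬝ᵥ u = 1)
    (hpu : p ⬝ᵥ u = 0) : orthoMatrix p u ∈ Matrix.specialOrthogonalGroup (Fin 3) ℝ := by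
  simp only [dotProduct, Fin.sum_univ_three] at hp hu hpu
  -- Lagrange's identity `|p × u|² = |p|² |u|² - (p · u)²`. The same quantity is the determinant of
  -- the matrix.
  have hcross : (p 1 * u 2 - p 2 * u 1) ^ 2 + (p 2 * u 0 - p 0 * u 2) ^ 2
      + (p 0 * u 1 - p 1 * u 0) ^ 2 = 1 := by
    linear_combination (u 0 * u 0 + u 1 * u 1 + u 2 * u 2) * hp + hu
      - (p 0 * u 0 + p 1 * u 1 + p 2 * u 2) * hpu
  refine Matrix.mem_specialOrthogonalGroup_iff.2 ⟨?_, ?_⟩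
  · rw [Matrix.mem_orthogonalGroup_iff']
    ext i j
    fin_cases i <;> fin_cases j <;>
      simp [orthoMatrix, Matrix.mul_apply, Fin.sum_univ_three] <;>
      first
      | ring1
      | linear_combination hp
      | linear_combination hu
      | linear_combination hpu
      | linear_combination hcross
  · rw [Matrix.det_fin_three]
    simp [orthoMatrix]
    linear_combination hcross

/-- For `g` in `SO(3)` the transpose is the adjugate. Its last row consists of cofactors, so the
third column of `g` is the cross product of the first two. -/
lemma orthoMatrix_eq {g : Mat} (hg : g ∈ Matrix.specialOrthogonalGroup (Fin 3) ℝ) :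
    orthoMatrix (fun i => g i 0) (fun i => g i 1) = g := by
  have hadj : g.transpose = g.adjugate := by
    calc g.transpose = g.transpose * (g * g.adjugate) := by
          rw [Matrix.mul_adjugate, (Matrix.mem_specialOrthogonalGroup_iff.1 hg).2, one_smul,
            Matrix.mul_one]
      _ = g.adjugate := by
          rw [← Matrix.mul_assoc, transpose_mul_self_of_mem hg, Matrix.one_mul]
  rw [Matrix.adjugate_fin_three] at hadj
  have h := fun i => congrFun (congrFun hadj 2) i
  have h0 := h 0
  have h1 := h 1
  have h2 := h 2
  simp at h0 h1 h2
  ext i j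
  fin_cases i <;> fin_cases j <;> simp [orthoMatrix, h0, h1, h2] <;> ring

/-- The inverse of `toTS2`. -/
def ofTS2 (q : (Fin 3 → ℝ) × (Fin 3 → ℝ)) : Amb :=
  (Matrix.of.symm (orthoMatrix q.1 (-((length q.2)⁻¹ • q.2))), length q.2)

lemma toTS2_mem {m : Amb} (hm : m ∈ GW) : toTS2 m ∈ TplusS2 := by
  have h := transpose_mul_self_of_mem hm.1
  have h' := fun i j => congrFun (congrFun h i) j
  simp only [Matrix.mul_apply, Fin.sum_univ_three, Matrix.transpose_apply, Matrix.of_apply] at h'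
  have h00 := h' 0 0
  have h01 := h' 0 1
  have h11 := h' 1 1
  simp at h00 h01 h11
  rw [toTS2_eq]
  refine ⟨?_, ?_, fun h0 => ?_⟩
  · simp only [dotProduct, Fin.sum_univ_three]
    exact h00
  · simp only [dotProduct, Fin.sum_univ_three]
    linear_combination -m.2 * h01
  · have hz := fun i => congrFun h0 i
    have hx := hm.2.ne'
    have z0 := hz 0
    have z1 := hz 1
    have z2 := hz 2
    simp [hx] at z0 z1 z2
    simp [z0, z1, z2] at h11

lemma ofTS2_toTS2 {m : Amb} (hm : m ∈ GW) : ofTS2 (toTS2 m) = m := by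
  have h := congrFun (congrFun (transpose_mul_self_of_mem hm.1) 1) 1
  simp [Matrix.mul_apply, Fin.sum_univ_three] at h
  have hl : length (fun i => -(m.2 * m.1 i 1)) = m.2 := by
    refine (sq_eq_sq₀ (length_nonneg _) hm.2.le).1 ?_
    rw [length_sq]
    simp only [dotProduct, Fin.sum_univ_three]
    linear_combination m.2 ^ 2 * h
  rw [toTS2_eq, ofTS2, hl]
  refine Prod.ext ?_ rfl
  have hu : (-(m.2⁻¹ • fun i => -(m.2 * m.1 i 1)) : Fin 3 → ℝ) = fun i => mat m i 1 := by
    ext i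
    have hx := hm.2.ne'
    simp
    field_simp
  simp only [hu]
  exact orthoMatrix_eq hm.1

lemma ofTS2_mem {q : (Fin 3 → ℝ) × (Fin 3 → ℝ)} (hq : q ∈ TplusS2) : ofTS2 q ∈ GW := by
  have hl := length_pos hq.2.2
  refine ⟨orthoMatrix_mem hq.1 ?_ ?_, hl⟩
  · rw [neg_dotProduct_neg, smul_dotProduct, dotProduct_smul, ← length_sq]
    simp only [smul_eq_mul]
    field_simp
  · rw [dotProduct_neg, dotProduct_smul, hq.2.1, smul_zero, neg_zero]

lemma toTS2_ofTS2 {q : (Fin 3 → ℝ) × (Fin 3 → ℝ)} (hq : q ∈ TplusS2) :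
    toTS2 (ofTS2 q) = q := by
  have hl := (length_pos hq.2.2).ne'
  rw [toTS2_eq]
  refine Prod.ext (funext fun i => ?_) (funext fun i => ?_)
  · fin_cases i <;> simp [ofTS2, orthoMatrix]
  · fin_cases i <;> simp [ofTS2, orthoMatrix] <;> field_simp

lemma contDiffOn_ofTS2 {n : WithTop ℕ∞} : ContDiffOn ℝ n ofTS2 {q | q.2 ≠ 0} := by
  have hl : ContDiffOn ℝ n
      (fun q : (Fin 3 → ℝ) × (Fin 3 → ℝ) => length q.2) {q | q.2 ≠ 0} := by
    refine ContDiffOn.sqrt ?_ fun q hq h0 => hq (dotProduct_self_eq_zero.1 h0)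
    simp only [dotProduct]
    fun_prop
  have hi := hl.inv fun q hq => (length_pos hq).ne'
  refine ContDiffOn.prodMk (contDiffOn_pi.2 fun i => contDiffOn_pi.2 fun j => ?_) hl
  have h1 : ∀ k, ContDiffOn ℝ n (fun q : (Fin 3 → ℝ) × (Fin 3 → ℝ) => q.1 k) {q | q.2 ≠ 0} :=
    fun k => by fun_prop
  have h2 : ∀ k, ContDiffOn ℝ n
      (fun q : (Fin 3 → ℝ) × (Fin 3 → ℝ) => (-((length q.2)⁻¹ • q.2)) k) {q | q.2 ≠ 0} :=
    fun k => (hi.mul (by fun_prop)).neg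
  fin_cases j
  · exact h1 i
  · exact h2 i
  · fin_cases i
    · exact ((h1 1).mul (h2 2)).sub ((h1 2).mul (h2 1))
    · exact ((h1 2).mul (h2 0)).sub ((h1 0).mul (h2 2))
    · exact ((h1 0).mul (h2 1)).sub ((h1 1).mul (h2 0))

theorem isEquivariantDiffeo_toTS2 : IsEquivariantDiffeo toTS2 where
  bijOn := Set.InvOn.bijOn ⟨fun _ hm => ofTS2_toTS2 hm, fun _ hq => toTS2_ofTS2 hq⟩
    (fun _ hm => toTS2_mem hm) (fun _ hq => ofTS2_mem hq)
  equivariant h _ m _ := toTS2_equivariant h m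
  smooth := contDiff_toTS2
  smooth_inverse := ⟨{q | q.2 ≠ 0}, ofTS2, isOpen_ne_fun continuous_snd continuous_const,
    fun _ hq => hq.2.2, contDiffOn_ofTS2, fun _ hm => ofTS2_toTS2 hm⟩

section Coefficients

variable {F : Type} [NormedAddCommGroup F] [NormedSpace ℝ F] {k : ℕ}

/-! ### Forms with coefficients depending on `x` only -/

lemma frame_add (m : GW) (u v : Coord) : frame m (u + v) = frame m u + frame m v := by
  have hs : skew (u + v) = skew u + skew v := by
    simp only [skew, Pi.add_apply]
    module
  refine Subtype.ext (Prod.ext ?_ ?_)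
  · change mat (leftField (u + v) m.1) = mat (leftField u m.1) + mat (leftField v m.1)
    rw [leftField_fst, leftField_fst, leftField_fst, hs, Matrix.mul_add]
  · change (leftField (u + v) m.1).2 = (leftField u m.1).2 + (leftField v m.1).2
    simp only [leftField_snd, Pi.add_apply]

lemma frame_smul (m : GW) (c : ℝ) (u : Coord) : frame m (c • u) = c • frame m u := by
  have hs : skew (c • u) = c • skew u := by
    simp only [skew, Pi.smul_apply, smul_eq_mul]
    module
  refine Subtype.ext (Prod.ext ?_ ?_)
  · change mat (leftField (c • u) m.1) = c • mat (leftField u m.1)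
    rw [leftField_fst, leftField_fst, hs, Matrix.mul_smul]
  · change (leftField (c • u) m.1).2 = c • (leftField u m.1).2
    simp only [leftField_snd, Pi.smul_apply]

/-- The left-invariant frame as a linear map. -/
def frameLinear (m : GW) : Coord →ₗ[ℝ] tangent m.1 where
  toFun := frame m
  map_add' := frame_add m
  map_smul' := frame_smul m

lemma HasCoeffs.isLeftInvariant {α : Form F k} {A : (Fin k → Coord) → ℝ → F}
    (hA : HasCoeffs α A) : IsLeftInvariant α := by
  intro h m
  ext v
  have hv : v = fun i => frame m (coord m (v i)) := funext fun i => (frame_coord m (v i)).symm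
  rw [hv, hA m, AlternatingMap.compLinearMap_apply]
  simp only [leftMulTangent_frame]
  exact hA (leftMul h m) fun i => coord m (v i)

/-- The coefficients of a form along `{1} × W⁺`. -/
def baseCoeffs (α : Form F k) (w : Fin k → Coord) (x : ℝ) : F :=
  if hx : 0 < x then α (basePoint x hx) (fun i => frame (basePoint x hx) (w i)) else 0

/-- Left translation by `g` carries `(1, x)` to `(g, x)` and frame vectors to frame vectors with the
same coordinates. -/
lemma IsLeftInvariant.hasCoeffs {α : Form F k} (hα : IsLeftInvariant α) :
    HasCoeffs α (baseCoeffs α) := by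
  intro m w
  obtain ⟨h, hh⟩ := exists_leftMul_basePoint m
  have h1 := congrArg (fun β => β (fun i => frame (basePoint m.1.2 m.2.2) (w i)))
    (hα h (basePoint m.1.2 m.2.2))
  simp only [AlternatingMap.compLinearMap_apply, leftMulTangent_frame] at h1
  rw [baseCoeffs, dif_pos m.2.2, ← h1, hh]

/-- Restrict an ambient extension to the line `y ↦ (1, y)`: the frame vectors are constant there, so
the coefficient is a fixed evaluation of a smooth family. -/
lemma HasCoeffs.contDiffOn {α : Form F k} {A : (Fin k → Coord) → ℝ → F} (hA : HasCoeffs α A)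
    (hα : IsSmoothForm α) (w : Fin k → Coord) :
    ContDiffOn ℝ (⊤ : ℕ∞) (A w) (Set.Ioi 0) := by
  intro x hx
  refine ContDiffAt.contDiffWithinAt ?_
  obtain ⟨U, hU, hxU, η, hη⟩ := hα (basePoint x hx)
  have hc : ContDiff ℝ (⊤ : ℕ∞) (fun y : ℝ => ((Matrix.of.symm 1, y) : Amb)) := by fun_prop
  have hη' : ContDiffAt ℝ (⊤ : ℕ∞) η (Matrix.of.symm 1, x) := hη.1.contDiffAt (hU.mem_nhds hxU)
  have h1 : ContDiffAt ℝ (⊤ : ℕ∞) (fun y : ℝ => η (Matrix.of.symm 1, y)) x :=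
    hη'.comp x hc.contDiffAt
  have hw : ∀ (u : Coord) (y : ℝ), leftField u (Matrix.of.symm 1, y)
      = (Matrix.of.symm (skew u), u 3) :=
    fun u y => Prod.ext ((leftField_fst _ _).trans (Matrix.one_mul _)) (leftField_snd _ _)
  have h2 := (ContinuousAlternatingMap.apply ℝ Amb F
    fun i => (Matrix.of.symm (skew (w i)), w i 3)).contDiff.contDiffAt.comp x h1
  refine h2.congr_of_eventuallyEq ?_
  have h3 : ∀ᶠ y in 𝓝 x, ((Matrix.of.symm 1, y) : Amb) ∈ U :=
    hc.continuous.continuousAt.eventually_mem (hU.mem_nhds hxU)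
  filter_upwards [h3, lt_mem_nhds (show 0 < x from hx)] with y hyU hy
  refine Eq.trans ?_ (congrArg (η (Matrix.of.symm 1, y)) (funext fun i => hw (w i) y))
  exact ((hη.2 (basePoint y hy) hyU fun i => frame _ (w i)).trans (hA (basePoint y hy) w)).symm

/-- The coefficients of the `1`-form `∑ i, a i(x) eⁱ`. -/
def oneCoeffs (a : Fin 4 → ℝ → F) (w : Fin 1 → Coord) (x : ℝ) : F := ∑ i, w 0 i • a i x

/-- The coefficients of the exterior derivative of `∑ i, a i(x) eⁱ`, where `a'` is the derivative
of `a`. -/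
def dOneCoeffs (a a' : Fin 4 → ℝ → F) (w : Fin 2 → Coord) (x : ℝ) : F :=
  w 0 3 • (∑ i, w 1 i • a' i x) - w 1 3 • (∑ i, w 0 i • a' i x)
    - ∑ i, bracket (w 0) (w 1) i • a i x

/-- The `1`-forms of the left-invariant coframe, extended to the ambient space. -/
def coframe (m : Amb) (i : Fin 4) : Amb →L[ℝ] ℝ :=
  LinearMap.toContinuousLinearMap
    { toFun := fun v => (![((mat m).transpose * mat v) 0 1, ((mat m).transpose * mat v) 0 2,
        ((mat m).transpose * mat v) 1 2, v.2] : Coord) i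
      map_add' := fun u v => by
        have h : (mat m).transpose * mat (u + v)
            = (mat m).transpose * mat u + (mat m).transpose * mat v :=
          Matrix.mul_add _ (mat u) (mat v)
        rw [h]
        fin_cases i <;> simp
      map_smul' := fun c v => by
        have h : (mat m).transpose * mat (c • v) = c • ((mat m).transpose * mat v) :=
          Matrix.mul_smul _ c (mat v)
        rw [h]
        fin_cases i <;> simp }

lemma coframe_frame (m : GW) (w : Coord) (i : Fin 4) : coframe m.1 i (frame m w).1 = w i :=
  congrFun (coord_frame m w) i

lemma contDiff_coframe (i : Fin 4) {n : WithTop ℕ∞} : ContDiff ℝ n (fun m => coframe m i) := by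
  refine contDiff_clm_apply_iff.2 fun v => ?_
  fin_cases i <;> simp [coframe, Matrix.mul_apply, Fin.sum_univ_three] <;> fun_prop

lemma isOpen_pos : IsOpen {m : Amb | 0 < m.2} := isOpen_lt continuous_const continuous_snd

lemma exists_isSmoothExtension {a : Fin 4 → ℝ → F}
    (ha : ∀ i, ContDiffOn ℝ (⊤ : ℕ∞) (a i) (Set.Ioi 0)) {α : Form F 1}
    (hα : HasCoeffs α (oneCoeffs a)) : ∃ η, IsSmoothExtension α {m | 0 < m.2} η := by
  refine ⟨fun m => ContinuousAlternatingMap.ofSubsingletonLIE (𝕜 := ℝ) (E := Amb) (F := F)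
    (0 : Fin 1) (∑ i, (coframe m i).smulRight (a i m.2)), ?_, ?_⟩
  · refine (ContinuousAlternatingMap.ofSubsingletonLIE (𝕜 := ℝ) (E := Amb) (F := F)
      (0 : Fin 1)).contDiff.comp_contDiffOn ?_
    refine ContDiffOn.sum fun i _ => ContDiffOn.smulRight (contDiff_coframe i).contDiffOn ?_
    exact (ha i).comp contDiff_snd.contDiffOn fun _ hm => hm
  · intro m _ v
    have hv : v = fun i => frame m (coord m (v i)) := funext fun i => (frame_coord m (v i)).symm
    rw [hv, hα m]
    simp [oneCoeffs, coframe_frame]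

lemma HasCoeffs.congr {α : Form F k} {A B : (Fin k → Coord) → ℝ → F} (hA : HasCoeffs α A)
    (h : ∀ w x, 0 < x → A w x = B w x) : HasCoeffs α B :=
  fun m w => (hA m w).trans (h w _ m.2.2)

lemma dOneCoeffs_eq {a a' : Fin 4 → ℝ → F}
    (ha' : ∀ i x, 0 < x → HasDerivAt (a i) (a' i x) x) (w : Fin 2 → Coord) {x : ℝ} (hx : 0 < x) :
    w 0 3 • deriv (oneCoeffs a ![w 1]) x - w 1 3 • deriv (oneCoeffs a ![w 0]) x
      - oneCoeffs a ![bracket (w 0) (w 1)] x = dOneCoeffs a a' w x := by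
  have h : ∀ u : Coord, deriv (oneCoeffs a ![u]) x = ∑ i, u i • a' i x := fun u =>
    (HasDerivAt.fun_sum fun i _ => (ha' i x hx).const_smul (u i)).deriv
  rw [h, h]
  rfl

/-- This replaces the local definition of `β = dα` by an identity of coefficients. One direction
uses that any extension gives the same values on tangent vectors, the other the explicit extension
`∑ a i(x) coframe i`, valid on all of `x > 0`. -/
theorem isExtDeriv_iff_hasCoeffs {a a' : Fin 4 → ℝ → F}
    (ha : ∀ i, ContDiffOn ℝ (⊤ : ℕ∞) (a i) (Set.Ioi 0))
    (ha' : ∀ i x, 0 < x → HasDerivAt (a i) (a' i x) x) {α : Form F 1} {β : Form F 2}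
    (hα : HasCoeffs α (oneCoeffs a)) :
    IsExtDeriv α β ↔ HasCoeffs β (dOneCoeffs a a') := by
  constructor
  · intro h m w
    obtain ⟨U, hU, hm, η, hη, hd⟩ := h m
    rw [← hd m hm, ← dOneCoeffs_eq ha' w m.2.2]
    exact extDeriv_leftField_one hα hU hη m hm w
  · intro h m
    obtain ⟨η, hη⟩ := exists_isSmoothExtension ha hα
    refine ⟨_, isOpen_pos, m.2.2, η, hη, fun n hn v => ?_⟩
    have hv : v = fun i => frame n (coord n (v i)) := funext fun i => (frame_coord n (v i)).symm
    rw [hv, h n, ← dOneCoeffs_eq ha' _ n.2.2]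
    exact extDeriv_leftField_one hα isOpen_pos hη n hn fun i => coord n (v i)

lemma contDiffOn_extDeriv {U : Set Amb} (hU : IsOpen U) {η : Amb → Amb [⋀^Fin k]→L[ℝ] F}
    (hη : ContDiffOn ℝ (⊤ : ℕ∞) η U) : ContDiffOn ℝ (⊤ : ℕ∞) (extDeriv η) U :=
  (ContinuousAlternatingMap.alternatizeUncurryFinCLM ℝ Amb F).contDiff.comp_contDiffOn
    (hη.fderiv_of_isOpen hU (by simp))

lemma IsExtDeriv.isSmoothForm {α : Form F k} {β : Form F (k + 1)} (h : IsExtDeriv α β) :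
    IsSmoothForm β := by
  intro m
  obtain ⟨U, hU, hm, η, hη, hd⟩ := h m
  exact ⟨U, hU, hm, extDeriv η, contDiffOn_extDeriv hU hη.1, hd⟩

lemma IsExtDeriv.isExtDeriv_zero {α : Form F k} {β : Form F (k + 1)} (h : IsExtDeriv α β) :
    IsExtDeriv β (fun _ => 0) := by
  intro m
  obtain ⟨U, hU, hm, η, hη, hd⟩ := h m
  refine ⟨U, hU, hm, extDeriv η, ⟨contDiffOn_extDeriv hU hη.1, hd⟩, fun n hn v => ?_⟩
  rw [extDeriv_extDeriv_apply (hη.1.contDiffAt (hU.mem_nhds hn))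
    (by simpa using (WithTop.coe_le_coe.2 le_top : ((2 : ℕ∞) : WithTop ℕ∞) ≤ (⊤ : ℕ∞)))]
  rfl

end Coefficients

/-! ### The forms `dθ̃ᵃ` and the Kähler conditions -/

/-- The coefficients `f', c_Y / sinh, c_Z / cosh, 0` of `θ̃ᵃ` in the left-invariant coframe. -/
def thetaCoeffs (f : ℝ → ℝ) (cZ cY : ℝ) : Fin 4 → ℝ → ℝ :=
  ![deriv f, fun x => cY / Real.sinh x, fun x => cZ / Real.cosh x, fun _ => 0]

/-- The derivatives of `thetaCoeffs`. -/
def thetaCoeffs' (f : ℝ → ℝ) (cZ cY : ℝ) : Fin 4 → ℝ → ℝ :=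
  ![deriv (deriv f), fun x => -(cY * Real.cosh x / Real.sinh x ^ 2),
    fun x => -(cZ * Real.sinh x / Real.cosh x ^ 2), fun _ => 0]

lemma hasCoeffs_theta (f : ℝ → ℝ) (cZ cY : ℝ) :
    HasCoeffs (theta (vectorFunction f cZ cY)) (oneCoeffs (thetaCoeffs f cZ cY)) := by
  intro m w
  change traceForm _ ((mat m.1).transpose * mat (frame m (w 0)).1) = _
  rw [transpose_mul_frame]
  simp [traceForm, vectorFunction, skew, X, Y, Z, oneCoeffs, thetaCoeffs, Matrix.trace,
    Fin.sum_univ_three, Fin.sum_univ_four]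
  ring

lemma contDiffOn_deriv {f : ℝ → ℝ} (hf : ContDiffOn ℝ (⊤ : ℕ∞) f (Set.Ioi 0)) :
    ContDiffOn ℝ (⊤ : ℕ∞) (deriv f) (Set.Ioi 0) :=
  hf.deriv_of_isOpen isOpen_Ioi (by simp)

lemma hasDerivAt_deriv {f : ℝ → ℝ} (hf : ContDiffOn ℝ (⊤ : ℕ∞) f (Set.Ioi 0)) {x : ℝ}
    (hx : 0 < x) : HasDerivAt (deriv f) (deriv (deriv f) x) x :=
  (((contDiffOn_deriv hf).contDiffAt (Ioi_mem_nhds hx)).differentiableAt (by simp)).hasDerivAt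

lemma contDiffOn_thetaCoeffs {f : ℝ → ℝ} (hf : ContDiffOn ℝ (⊤ : ℕ∞) f (Set.Ioi 0))
    (cZ cY : ℝ) (i : Fin 4) :
    ContDiffOn ℝ (⊤ : ℕ∞) (thetaCoeffs f cZ cY i) (Set.Ioi 0) := by
  fin_cases i
  · exact contDiffOn_deriv hf
  · exact contDiffOn_const.div Real.contDiff_sinh.contDiffOn
      fun x hx => (Real.sinh_pos_iff.2 hx).ne'
  · exact contDiffOn_const.div Real.contDiff_cosh.contDiffOn fun x _ => (Real.cosh_pos x).ne'
  · exact contDiffOn_const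

lemma hasDerivAt_thetaCoeffs {f : ℝ → ℝ} (hf : ContDiffOn ℝ (⊤ : ℕ∞) f (Set.Ioi 0))
    (cZ cY : ℝ) (i : Fin 4) (x : ℝ) (hx : 0 < x) :
    HasDerivAt (thetaCoeffs f cZ cY i) (thetaCoeffs' f cZ cY i x) x := by
  fin_cases i
  · exact hasDerivAt_deriv hf hx
  · have h := (hasDerivAt_const x cY).div (Real.hasDerivAt_sinh x) (Real.sinh_pos_iff.2 hx).ne'
    refine h.congr_deriv ?_
    change _ = -(cY * Real.cosh x / Real.sinh x ^ 2)
    ring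
  · have h := (hasDerivAt_const x cZ).div (Real.hasDerivAt_cosh x) (Real.cosh_pos x).ne'
    refine h.congr_deriv ?_
    change _ = -(cZ * Real.sinh x / Real.cosh x ^ 2)
    ring
  · exact hasDerivAt_const _ _

theorem isExtDeriv_theta_iff {f : ℝ → ℝ} (hf : ContDiffOn ℝ (⊤ : ℕ∞) f (Set.Ioi 0))
    (cZ cY : ℝ) (ω : Form ℝ 2) :
    IsExtDeriv (theta (vectorFunction f cZ cY)) ω ↔
      HasCoeffs ω (dOneCoeffs (thetaCoeffs f cZ cY) (thetaCoeffs' f cZ cY)) :=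
  isExtDeriv_iff_hasCoeffs (contDiffOn_thetaCoeffs hf cZ cY) (hasDerivAt_thetaCoeffs hf cZ cY)
    (hasCoeffs_theta f cZ cY)

lemma HasCoeffs.apply_pair {F : Type} [NormedAddCommGroup F] [NormedSpace ℝ F] {ω : Form F 2}
    {A : (Fin 2 → Coord) → ℝ → F} (hA : HasCoeffs ω A) (m : GW) (u v : Coord) :
    ω m ![frame m u, frame m v] = A ![u, v] m.1.2 := by
  rw [← hA m]
  congr 1
  ext1 i
  fin_cases i <;> rfl

lemma dOneCoeffs_theta (f : ℝ → ℝ) (cZ cY x : ℝ) (u v : Coord) :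
    dOneCoeffs (thetaCoeffs f cZ cY) (thetaCoeffs' f cZ cY) ![u, v] x
      = deriv (deriv f) x * (u 3 * v 0 - u 0 * v 3)
        - cY * Real.cosh x / Real.sinh x ^ 2 * (u 3 * v 1 - u 1 * v 3)
        - cZ * Real.sinh x / Real.cosh x ^ 2 * (u 3 * v 2 - u 2 * v 3)
        + deriv f x * (u 1 * v 2 - u 2 * v 1) - cY / Real.sinh x * (u 0 * v 2 - u 2 * v 0)
        + cZ / Real.cosh x * (u 0 * v 1 - u 1 * v 0) := by
  simp [dOneCoeffs, thetaCoeffs, thetaCoeffs', bracket, Fin.sum_univ_four]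
  ring

/-- The invariance rests on `c_Z / cosh` and `c_Y / sinh` having logarithmic derivatives `-tanh` and
`-coth` (for nonzero constants), matching the factors of `J_c`; the terms in `f'` and `f''` are
invariant for any `f`. -/
lemma dOneCoeffs_theta_coordJ (f : ℝ → ℝ) (cZ cY : ℝ) {x : ℝ} (hx : 0 < x) (u v : Coord) :
    dOneCoeffs (thetaCoeffs f cZ cY) (thetaCoeffs' f cZ cY) ![coordJ x u, coordJ x v] x
      = dOneCoeffs (thetaCoeffs f cZ cY) (thetaCoeffs' f cZ cY) ![u, v] x := by
  have hs := (Real.sinh_pos_iff.2 hx).ne'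
  have hc := (Real.cosh_pos x).ne'
  rw [dOneCoeffs_theta, dOneCoeffs_theta]
  simp [coordJ]
  field_simp
  ring

/-- The quadratic form `ω (J u, u)`, multiplied by `f'(x)`, as a sum of squares. -/
lemma dOneCoeffs_theta_coordJ_self (f : ℝ → ℝ) (cZ cY : ℝ) {x : ℝ} (hx : 0 < x) (u : Coord) :
    deriv f x * dOneCoeffs (thetaCoeffs f cZ cY) (thetaCoeffs' f cZ cY) ![coordJ x u, u] x
      = Real.cosh x / Real.sinh x * (deriv f x * u 1 - cY / Real.sinh x * u 0
          - Real.sinh x / Real.cosh x * (cZ / Real.cosh x) * u 3) ^ 2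
        + Real.sinh x / Real.cosh x * (deriv f x * u 2 - cZ / Real.cosh x * u 0
          + Real.cosh x / Real.sinh x * (cY / Real.sinh x) * u 3) ^ 2
        + Real.cosh x * Real.sinh x * (deriv (deriv f) x * deriv f x
            / (Real.cosh x * Real.sinh x)
          - cZ ^ 2 / Real.cosh x ^ 4 - cY ^ 2 / Real.sinh x ^ 4) * (u 0 ^ 2 + u 3 ^ 2) := by
  have hs := (Real.sinh_pos_iff.2 hx).ne'
  have hc := (Real.cosh_pos x).ne'
  rw [dOneCoeffs_theta]
  simp [coordJ]
  field_simp
  ring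

lemma IsAdmissible.deriv_pos {f : ℝ → ℝ} {cZ cY : ℝ} (h : IsAdmissible f cZ cY) {x : ℝ}
    (hx : 0 < x) : 0 < deriv f x := by
  have hs := Real.sinh_pos_iff.2 hx
  have hc := Real.cosh_pos x
  have h1 := h.det_pos x hx
  have h2 : 0 ≤ cZ ^ 2 / Real.cosh x ^ 4 := by positivity
  have h3 : 0 ≤ cY ^ 2 / Real.sinh x ^ 4 := by positivity
  have h4 : 0 < deriv (deriv f) x * deriv f x / (Real.cosh x * Real.sinh x) := by linarith
  have h5 : 0 < deriv (deriv f) x * deriv f x :=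
    (div_pos_iff_of_pos_right (mul_pos hc hs)).1 h4
  exact (pos_iff_pos_of_mul_pos h5).1 (h.pos x hx)

lemma IsAdmissible.coeffs_pos {f : ℝ → ℝ} {cZ cY : ℝ} (h : IsAdmissible f cZ cY) {x : ℝ}
    (hx : 0 < x) {u : Coord} (hu : u ≠ 0) :
    0 < dOneCoeffs (thetaCoeffs f cZ cY) (thetaCoeffs' f cZ cY) ![coordJ x u, u] x := by
  have hs := Real.sinh_pos_iff.2 hx
  have hc := Real.cosh_pos x
  have hb := h.deriv_pos hx
  refine pos_of_mul_pos_right ?_ hb.le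
  rw [dOneCoeffs_theta_coordJ_self f cZ cY hx]
  have hD := h.det_pos x hx
  -- The determinant term is positive unless `u 0` and `u 3` vanish. In that case the two squares
  -- reduce to `(f' u 1) ^ 2` and `(f' u 2) ^ 2`, with positive weights.
  by_cases hz : u 0 = 0 ∧ u 3 = 0
  · have hz' : u 1 ≠ 0 ∨ u 2 ≠ 0 := by
      by_contra! hn
      refine hu (funext fun i => ?_)
      fin_cases i
      exacts [hz.1, hn.1, hn.2, hz.2]
    rw [hz.1, hz.2]
    simp only [mul_zero, sub_zero, add_zero, ne_eq, OfNat.ofNat_ne_zero, not_false_eq_true,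
      zero_pow]
    rcases hz' with h1 | h2
    · positivity
    · positivity
  · have hz' : 0 < u 0 ^ 2 + u 3 ^ 2 := by
      by_cases h0 : u 0 = 0
      · have h3 : u 3 ≠ 0 := fun h3 => hz ⟨h0, h3⟩
        positivity
      · positivity
    positivity

theorem isInvariantKahler_of_isExtDeriv {f : ℝ → ℝ} {cZ cY : ℝ} (h : IsAdmissible f cZ cY)
    {ω : Form ℝ 2} (hω : IsExtDeriv (theta (vectorFunction f cZ cY)) ω) :
    IsInvariantKahler ω := by
  have hA := (isExtDeriv_theta_iff h.smooth cZ cY ω).1 hω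
  refine ⟨hω.isSmoothForm, hω.isExtDeriv_zero, hA.isLeftInvariant, fun m u v => ?_,
    fun m u hu => ?_⟩
  · rw [← frame_coord m u, ← frame_coord m v, Jc_frame, Jc_frame, hA.apply_pair,
      hA.apply_pair, dOneCoeffs_theta_coordJ f cZ cY m.2.2]
  · rw [← frame_coord m u, Jc_frame, hA.apply_pair]
    refine h.coeffs_pos m.2.2 fun h0 => hu ?_
    rw [← frame_coord m u, h0]
    exact map_zero (frameLinear m)

/-! ### Every invariant Kähler form is of the form `dθ̃ᵃ` -/

/-- The bilinear form on `𝔤 × ℝ` induced by a `2`-form at a point. -/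
def coordForm (ω : Form ℝ 2) (m : GW) : Coord [⋀^Fin 2]→ₗ[ℝ] ℝ :=
  (ω m).compLinearMap (frameLinear m)

lemma alternating_pair_expand (B : Coord [⋀^Fin 2]→ₗ[ℝ] ℝ) (u v : Coord) :
    B ![u, v] = B ![Pi.single 0 1, Pi.single 1 1] * (u 0 * v 1 - u 1 * v 0)
      + B ![Pi.single 0 1, Pi.single 2 1] * (u 0 * v 2 - u 2 * v 0)
      + B ![Pi.single 1 1, Pi.single 2 1] * (u 1 * v 2 - u 2 * v 1)
      + B ![Pi.single 0 1, Pi.single 3 1] * (u 0 * v 3 - u 3 * v 0)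
      + B ![Pi.single 1 1, Pi.single 3 1] * (u 1 * v 3 - u 3 * v 1)
      + B ![Pi.single 2 1, Pi.single 3 1] * (u 2 * v 3 - u 3 * v 2) := by
  have hu : ∀ u : Coord, u = u 0 • Pi.single 0 1 + u 1 • Pi.single 1 1 + u 2 • Pi.single 2 1
      + u 3 • Pi.single 3 1 := by
    intro u
    ext i
    fin_cases i <;> simp
  have hadd1 : ∀ a b c : Coord, B ![a + b, c] = B ![a, c] + B ![b, c] := fun a b c =>
    B.map_vecCons_add ![c] a b
  have hsmul1 : ∀ (r : ℝ) (a c : Coord), B ![r • a, c] = r * B ![a, c] := fun r a c =>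
    B.map_vecCons_smul ![c] r a
  have hswap : ∀ a b : Coord, B ![a, b] = -B ![b, a] := by
    intro a b
    have h := B.map_swap ![b, a] (i := 0) (j := 1) (by decide)
    rw [← h]
    congr 1
    ext1 i
    fin_cases i <;> rfl
  have hself : ∀ a : Coord, B ![a, a] = 0 := fun a => by linarith [hswap a a]
  have hadd2 : ∀ a b c : Coord, B ![c, a + b] = B ![c, a] + B ![c, b] := fun a b c => by
    rw [hswap, hadd1, hswap a, hswap b]
    ring
  have hsmul2 : ∀ (r : ℝ) (a c : Coord), B ![c, r • a] = r * B ![c, a] := fun r a c => by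
    rw [hswap, hsmul1, hswap a]
    ring
  conv_lhs => rw [hu u, hu v]
  simp only [hadd1, hadd2, hsmul1, hsmul2, hself]
  rw [hswap (Pi.single 1 1) (Pi.single 0 1), hswap (Pi.single 2 1) (Pi.single 0 1),
    hswap (Pi.single 3 1) (Pi.single 0 1), hswap (Pi.single 2 1) (Pi.single 1 1),
    hswap (Pi.single 3 1) (Pi.single 1 1), hswap (Pi.single 3 1) (Pi.single 2 1)]
  ring

lemma HasCoeffs.expand {ω : Form ℝ 2} {A : (Fin 2 → Coord) → ℝ → ℝ} (hA : HasCoeffs ω A)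
    {x : ℝ} (hx : 0 < x) (u v : Coord) :
    A ![u, v] x = A ![Pi.single 0 1, Pi.single 1 1] x * (u 0 * v 1 - u 1 * v 0)
      + A ![Pi.single 0 1, Pi.single 2 1] x * (u 0 * v 2 - u 2 * v 0)
      + A ![Pi.single 1 1, Pi.single 2 1] x * (u 1 * v 2 - u 2 * v 1)
      + A ![Pi.single 0 1, Pi.single 3 1] x * (u 0 * v 3 - u 3 * v 0)
      + A ![Pi.single 1 1, Pi.single 3 1] x * (u 1 * v 3 - u 3 * v 1)
      + A ![Pi.single 2 1, Pi.single 3 1] x * (u 2 * v 3 - u 3 * v 2) := by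
  have h : ∀ w : Fin 2 → Coord, coordForm ω (basePoint x hx) w = A w x := hA (basePoint x hx)
  simpa only [h] using alternating_pair_expand (coordForm ω (basePoint x hx)) u v

/-- Evaluate `dω = 0` on `∂/∂x, u, v`. As `∂/∂x` is central and `u, v` have no `∂/∂x` component,
only one derivative and one bracket term survive. -/
lemma HasCoeffs.closed {ω : Form ℝ 2} {A : (Fin 2 → Coord) → ℝ → ℝ} (hA : HasCoeffs ω A)
    (hω : IsExtDeriv ω (fun _ => 0)) {x : ℝ} (hx : 0 < x) (u v : Coord) (hu : u 3 = 0)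
    (hv : v 3 = 0) : deriv (A ![u, v]) x = A ![bracket u v, Pi.single 3 1] x := by
  obtain ⟨U, hU, hm, η, hη, hd⟩ := hω (basePoint x hx)
  have h1 := extDeriv_leftField_two hA hU hη (basePoint x hx) hm ![Pi.single 3 1, u, v]
  have h2 := hd (basePoint x hx) hm fun i => frame _ ((![Pi.single 3 1, u, v] : Fin 3 → Coord) i)
  have hb : ∀ u : Coord, bracket (Pi.single 3 1) u = 0 := fun u => by
    ext i
    fin_cases i <;> simp [bracket]
  have h0 : ∀ u : Coord, A ![0, u] x = 0 := fun u => by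
    rw [hA.expand hx]
    simp
  have h4 : deriv (A ![u, v]) x - A ![bracket u v, Pi.single 3 1] x = 0 := by
    simpa [hu, hv, hb, h0, basePoint] using h1.symm.trans (show _ = (0 : ℝ) from h2)
  linarith

/-- The equation says `(r φ)' = 0`, so `r φ` is constant on the half-line; the constant is its value
at `1`. -/
lemma exists_eq_div_of_deriv_mul_eq {r φ φ' : ℝ → ℝ} (hφ : ∀ x, 0 < x → HasDerivAt φ (φ' x) x)
    (hpos : ∀ x, 0 < x → φ x ≠ 0)
    (hr : ∀ x, 0 < x → DifferentiableAt ℝ r x)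
    (h : ∀ x, 0 < x → deriv r x * φ x = -(φ' x * r x)) :
    ∃ c : ℝ, ∀ x, 0 < x → r x = c / φ x := by
  have hd : ∀ x, 0 < x → HasDerivAt (fun y => r y * φ y) 0 x := fun x hx => by
    have h1 := (hr x hx).hasDerivAt.mul (hφ x hx)
    have h2 : deriv r x * φ x + r x * φ' x = 0 := by linear_combination h x hx
    rw [h2] at h1
    exact h1
  refine ⟨r 1 * φ 1, fun x hx => ?_⟩
  rw [eq_div_iff (hpos x hx)]
  exact (convex_Ioi (0 : ℝ)).is_const_of_fderivWithin_eq_zero (𝕜 := ℝ)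
    (fun y hy => (hd y hy).differentiableAt.differentiableWithinAt)
    (fun y hy => by
      have h := (hd y hy).hasFDerivAt.hasFDerivWithinAt (s := Set.Ioi 0) |>.fderivWithin
        (isOpen_Ioi.uniqueDiffWithinAt hy)
      rw [h]
      ext
      simp) hx (Set.mem_Ioi.2 one_pos)

lemma exists_primitive {p : ℝ → ℝ} (hp : ContDiffOn ℝ (⊤ : ℕ∞) p (Set.Ioi 0)) :
    ∃ f : ℝ → ℝ, ContDiffOn ℝ (⊤ : ℕ∞) f (Set.Ioi 0) ∧ ∀ x, 0 < x → deriv f x = p x := by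
  have hd : ∀ x, 0 < x → HasDerivAt (fun y => ∫ t in (1 : ℝ)..y, p t) (p x) x := by
    intro x hx
    have hsub : Set.uIcc 1 x ⊆ Set.Ioi 0 := fun y hy =>
      lt_of_lt_of_le (lt_min one_pos hx) hy.1
    exact intervalIntegral.integral_hasDerivAt_right
      (hp.continuousOn.mono hsub).intervalIntegrable
      (hp.continuousOn.stronglyMeasurableAtFilter isOpen_Ioi x hx)
      (hp.continuousOn.continuousAt (Ioi_mem_nhds hx))
  refine ⟨_, ?_, fun x hx => (hd x hx).deriv⟩
  refine (contDiffOn_infty_iff_deriv_of_isOpen isOpen_Ioi).2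
    ⟨fun x hx => (hd x hx).differentiableAt.differentiableWithinAt, ?_⟩
  exact hp.congr fun x hx => (hd x hx).deriv

lemma isAdmissible_of_coeffs_pos {f : ℝ → ℝ} {cZ cY : ℝ}
    (hf : ContDiffOn ℝ (⊤ : ℕ∞) f (Set.Ioi 0))
    (h : ∀ x, 0 < x → ∀ u : Coord, u ≠ 0 →
      0 < dOneCoeffs (thetaCoeffs f cZ cY) (thetaCoeffs' f cZ cY) ![coordJ x u, u] x) :
    IsAdmissible f cZ cY := by
  refine ⟨hf, fun x hx => ?_, fun x hx => ?_⟩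
  · have h0 := h x hx (Pi.single 0 1) (by simp)
    rw [dOneCoeffs_theta] at h0
    simpa [coordJ] using h0
  · have hs := Real.sinh_pos_iff.2 hx
    have hc := Real.cosh_pos x
    have hb : 0 < deriv f x := by
      have h1 := h x hx (Pi.single 1 1) (by simp)
      rw [dOneCoeffs_theta] at h1
      have h2 : 0 < deriv f x * (Real.cosh x / Real.sinh x) := by simpa [coordJ] using h1
      exact pos_of_mul_pos_left h2 (by positivity)
    -- This test vector, proportional to `a(x)`'s coordinates, annihilates both squares in the
    -- sum-of-squares formula and leaves the determinant expression times `cosh x sinh x f'(x) ^ 2`.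
    have h1 := mul_pos hb (h x hx
      ![deriv f x, cY / Real.sinh x, cZ / Real.cosh x, 0] fun h0 => hb.ne' (congrFun h0 0))
    rw [dOneCoeffs_theta_coordJ_self f cZ cY hx] at h1
    simp only [Matrix.cons_val, mul_zero, sub_zero, add_zero] at h1
    have h2 : 0 < Real.cosh x * Real.sinh x * deriv f x ^ 2 := by positivity
    refine pos_of_mul_pos_right (lt_of_lt_of_eq h1 ?_) h2.le
    ring

theorem exists_isAdmissible_of_isInvariantKahler {ω : Form ℝ 2} (hω : IsInvariantKahler ω) :
    ∃ (f : ℝ → ℝ) (cZ cY : ℝ), IsAdmissible f cZ cY ∧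
      IsExtDeriv (theta (vectorFunction f cZ cY)) ω := by
  have hA := hω.invariant.hasCoeffs
  set A := baseCoeffs ω
  have hsm := hA.contDiffOn hω.smooth
  have hdiff : ∀ w x, 0 < x → DifferentiableAt ℝ (A w) x := fun w x hx =>
    ((hsm w).contDiffAt (Ioi_mem_nhds hx)).differentiableAt (by simp)
  have hJ : ∀ x, 0 < x → ∀ u v : Coord, A ![coordJ x u, coordJ x v] x = A ![u, v] x := by
    intro x hx u v
    have h := hω.compatible (basePoint x hx) (frame _ u) (frame _ v)
    rwa [Jc_frame, Jc_frame, hA.apply_pair, hA.apply_pair] at h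
  have hpos : ∀ x, 0 < x → ∀ u : Coord, u ≠ 0 → 0 < A ![coordJ x u, u] x := by
    intro x hx u hu
    have h := hω.positive (basePoint x hx) (frame _ u) fun h0 => hu <| by
      rw [← coord_frame (basePoint x hx) u, h0, ← map_zero (frameLinear (basePoint x hx))]
      exact coord_frame _ 0
    rwa [Jc_frame, hA.apply_pair] at h
  have hexp := fun x hx => hA.expand (x := x) hx
  set s01 := A ![Pi.single 0 1, Pi.single 1 1] with e01
  set s02 := A ![Pi.single 0 1, Pi.single 2 1] with e02
  set s12 := A ![Pi.single 1 1, Pi.single 2 1] with e12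
  set s03 := A ![Pi.single 0 1, Pi.single 3 1] with e03
  set s13 := A ![Pi.single 1 1, Pi.single 3 1] with e13
  set s23 := A ![Pi.single 2 1, Pi.single 3 1] with e23
  -- Closedness on the pairs from `X, Y, Z`, through the three structure equations of `so(3)`.
  have d01 : ∀ x, 0 < x → deriv s01 x = -s23 x := fun x hx => by
    rw [e01, hA.closed hω.closed hx _ _ (by simp) (by simp), hexp x hx]
    simp [bracket]
  have d02 : ∀ x, 0 < x → deriv s02 x = s13 x := fun x hx => by
    rw [e02, hA.closed hω.closed hx _ _ (by simp) (by simp), hexp x hx]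
    simp [bracket]
  have d12 : ∀ x, 0 < x → deriv s12 x = -s03 x := fun x hx => by
    rw [e12, hA.closed hω.closed hx _ _ (by simp) (by simp), hexp x hx]
    simp [bracket]
  -- `J_c`-invariance on `(X, Y)` and `(X, Z)`; combined with `d01` and `d02` it gives the linear
  -- equations for `s01` and `s02`.
  have j01 : ∀ x, 0 < x → s01 x * Real.sinh x = s23 x * Real.cosh x := fun x hx => by
    have hs := (Real.sinh_pos_iff.2 hx).ne'
    have h := hJ x hx (Pi.single 0 1) (Pi.single 1 1)
    rw [hexp x hx, ← e01] at h
    simp [coordJ] at h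
    rw [← h]
    field_simp
  have j02 : ∀ x, 0 < x → s02 x * Real.cosh x = -(s13 x * Real.sinh x) := fun x hx => by
    have hc := (Real.cosh_pos x).ne'
    have h := hJ x hx (Pi.single 0 1) (Pi.single 2 1)
    rw [hexp x hx, ← e02] at h
    simp [coordJ] at h
    rw [← h]
    field_simp
  obtain ⟨cZ, hcZ⟩ := exists_eq_div_of_deriv_mul_eq (r := s01) (fun x _ => Real.hasDerivAt_cosh x)
    (fun x _ => (Real.cosh_pos x).ne') (fun x hx => hdiff _ x hx) fun x hx => by
      rw [d01 x hx]
      linear_combination j01 x hx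
  obtain ⟨cY, hcY⟩ := exists_eq_div_of_deriv_mul_eq (r := s02) (fun x _ => Real.hasDerivAt_sinh x)
    (fun x hx => (Real.sinh_pos_iff.2 hx).ne') (fun x hx => hdiff _ x hx) fun x hx => by
      rw [d02 x hx]
      linear_combination j02 x hx
  -- The coefficient on `(Y, Z)` meets no differential equation of its own: it is taken as `f'`, and
  -- `d12` turns `s03` into `-f''`.
  obtain ⟨f, hf, hfd⟩ := exists_primitive (hsm ![Pi.single 1 1, Pi.single 2 1])
  have hfdd : ∀ x, 0 < x → deriv (deriv f) x = -s03 x := fun x hx => by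
    rw [← d12 x hx]
    refine Filter.EventuallyEq.deriv_eq ?_
    filter_upwards [Ioi_mem_nhds hx] with y hy using hfd y hy
  -- The sign of `cY` flips because `dθ̃ᵃ(X, Z) = -⟨a, [X, Z]⟩ = -⟨a, Y⟩`, whereas `[X, Y] = -Z`
  -- leaves the sign of `cZ` unchanged.
  have hω' : HasCoeffs ω (dOneCoeffs (thetaCoeffs f cZ (-cY)) (thetaCoeffs' f cZ (-cY))) := by
    refine hA.congr fun w x hx => ?_
    have hw : w = ![w 0, w 1] := by
      ext1 i
      fin_cases i <;> rfl
    have hs := (Real.sinh_pos_iff.2 hx).ne'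
    have hc := (Real.cosh_pos x).ne'
    have h13 := j02 x hx
    have h23 := j01 x hx
    rw [hcY x hx] at h13
    rw [hcZ x hx] at h23
    have h13' : s13 x = -(cY * Real.cosh x / Real.sinh x ^ 2) := by
      field_simp at h13 ⊢
      linear_combination h13
    have h23' : s23 x = cZ * Real.sinh x / Real.cosh x ^ 2 := by
      field_simp at h23 ⊢
      linear_combination -h23
    rw [hw, hexp x hx, dOneCoeffs_theta, hfd x hx, hfdd x hx, hcZ x hx, hcY x hx, h13', h23']
    ring
  refine ⟨f, cZ, -cY, isAdmissible_of_coeffs_pos hf fun x hx u hu => ?_,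
    (isExtDeriv_theta_iff hf _ _ _).2 hω'⟩
  exact lt_of_lt_of_eq (hpos x hx u hu)
    ((hA.apply_pair (basePoint x hx) _ _).symm.trans (hω'.apply_pair (basePoint x hx) _ _))

/-! ### The potential -/

/-- The `1`-form `2 f'(x) dx`. -/
def dPotential (f : ℝ → ℝ) : Form ℝ 1 := fun m =>
  AlternatingMap.ofSubsingleton ℝ _ _ 0
    ((2 * deriv f m.1.2) • (LinearMap.snd ℝ _ _ ∘ₗ (tangent m.1).subtype))

lemma dPotential_apply (f : ℝ → ℝ) (m : GW) (v : Fin 1 → tangent m.1) :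
    dPotential f m v = 2 * deriv f m.1.2 * (v 0).1.2 := rfl

lemma isExtDeriv_potential {f : ℝ → ℝ} (hf : ContDiffOn ℝ (⊤ : ℕ∞) f (Set.Ioi 0)) :
    IsExtDeriv (zeroForm fun m => 2 * f m.1.2) (dPotential f) := by
  intro m
  refine ⟨{n | 0 < n.2}, isOpen_pos, m.2.2,
    fun n => ContinuousAlternatingMap.constOfIsEmpty ℝ Amb (Fin 0) (2 * f n.2),
    ⟨?_, fun n _ v => rfl⟩, fun n hn v => ?_⟩
  · refine (ContinuousAlternatingMap.constOfIsEmptyLIE ℝ Amb ℝ (Fin 0)).contDiff.comp_contDiffOn ?_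
    exact contDiffOn_const.mul (hf.comp contDiff_snd.contDiffOn fun _ h => h)
  · have h1 : HasDerivAt f (deriv f n.1.2) n.1.2 :=
      ((hf.contDiffAt (Ioi_mem_nhds n.2.2)).differentiableAt (by simp)).hasDerivAt
    have h2 : HasFDerivAt (fun q : Amb => 2 * f q.2) _ n.1 :=
      (h1.const_mul 2).hasFDerivAt.comp n.1 (hasFDerivAt_snd (𝕜 := ℝ))
    rw [extDeriv_constOfIsEmpty, h2.fderiv, dPotential_apply]
    simp
    ring

theorem isKahlerPotential {f : ℝ → ℝ} {ω : Form ℝ 2} (hf : IsAdmissible f 0 0)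
    (hω : IsExtDeriv (theta (vectorFunction f 0 0)) ω) :
    IsKahlerPotential (fun m => 2 * f m.1.2) ω := by
  have hA := (isExtDeriv_theta_iff hf.smooth 0 0 ω).1 hω
  -- The expected value of `d∂Q` is `-iω`.
  let β : Form ℂ 2 := fun m =>
    (LinearMap.toSpanSingleton ℝ ℂ (-Complex.I)).compAlternatingMap (ω m)
  have hβ : ∀ (m : GW) (v : Fin 2 → tangent m.1), β m v = -Complex.I * (ω m v : ℂ) := by
    intro m v
    simp [β, mul_comm]
  have hsmooth : ContDiffOn ℝ (⊤ : ℕ∞) (fun x => ((deriv f x : ℝ) : ℂ)) (Set.Ioi 0) :=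
    Complex.ofRealCLM.contDiff.comp_contDiffOn (contDiffOn_deriv hf.smooth)
  have hderiv : ∀ x, 0 < x →
      HasDerivAt (fun x => ((deriv f x : ℝ) : ℂ)) (deriv (deriv f) x : ℝ) x := fun x hx =>
    (hasDerivAt_deriv hf.smooth hx).ofReal_comp
  -- Coefficients of `∂Q = f' dx - i θ̃ᵃ`: since `J_c X = ∂/∂x`, the form `dQ ∘ J_c` is `2 f'` times
  -- the coframe element dual to `X`.
  let a : Fin 4 → ℝ → ℂ :=
    ![fun x => -Complex.I * (deriv f x : ℝ), fun _ => 0, fun _ => 0, fun x => (deriv f x : ℝ)]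
  let a' : Fin 4 → ℝ → ℂ := ![fun x => -Complex.I * (deriv (deriv f) x : ℝ), fun _ => 0,
    fun _ => 0, fun x => (deriv (deriv f) x : ℝ)]
  have ha : ∀ i, ContDiffOn ℝ (⊤ : ℕ∞) (a i) (Set.Ioi 0) := by
    intro i
    fin_cases i
    exacts [contDiffOn_const.mul hsmooth, contDiffOn_const, contDiffOn_const, hsmooth]
  have ha' : ∀ i x, 0 < x → HasDerivAt (a i) (a' i x) x := by
    intro i x hx
    fin_cases i
    exacts [(hderiv x hx).const_mul _, hasDerivAt_const _ _, hasDerivAt_const _ _, hderiv x hx]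
  have hα : HasCoeffs (partOneZero (dPotential f)) (oneCoeffs a) := by
    intro m w
    change ((dPotential f m ![frame m (w 0)] : ℂ)
      - Complex.I * (dPotential f m ![Jc m (frame m (w 0))] : ℂ)) / 2 = _
    rw [Jc_frame, dPotential_apply, dPotential_apply]
    simp only [Matrix.cons_val_zero, frame_snd]
    simp [coordJ, oneCoeffs, a, Fin.sum_univ_four]
    ring
  refine ⟨dPotential f, β, isExtDeriv_potential hf.smooth,
    (isExtDeriv_iff_hasCoeffs ha ha' hα).2 fun m w => ?_, fun m u v => ?_⟩
  · rw [hβ, hA m]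
    simp [dOneCoeffs, a, a', thetaCoeffs, thetaCoeffs', bracket, Fin.sum_univ_four]
    ring
  -- As `ω` is `J_c`-invariant, averaging over `J_c` leaves `β` unchanged, and `i · (-i) = 1`.
  · rw [hβ, hβ, (isInvariantKahler_of_isExtDeriv hf hω).compatible m u v]
    linear_combination (ω m ![u, v] : ℂ) * Complex.I_sq

end PuncturedTS2

end

open PuncturedTS2 in
theorem corollary6p3 :
    -- the identification of `G × W⁺` with the punctured tangent bundle `T⁺S²`
    IsEquivariantDiffeo toTS2 ∧
    -- the `SO(3)`-invariant Kähler forms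
    (∀ ω : Form ℝ 2, IsInvariantKahler ω ↔
      ∃ (f : ℝ → ℝ) (cZ cY : ℝ), IsAdmissible f cZ cY ∧
        IsExtDeriv (theta (vectorFunction f cZ cY)) ω) ∧
    -- the Kähler potential in the case `c_Z = c_Y = 0`
    (∀ (f : ℝ → ℝ) (ω : Form ℝ 2), IsAdmissible f 0 0 →
      IsExtDeriv (theta (vectorFunction f 0 0)) ω →
      IsKahlerPotential (fun m => 2 * f m.1.2) ω) :=
  ⟨isEquivariantDiffeo_toTS2,
    fun _ => ⟨exists_isAdmissible_of_isInvariantKahler,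
      fun ⟨_, _, _, hf, hω⟩ => isInvariantKahler_of_isExtDeriv hf hω⟩,
    fun _ _ hf hω => isKahlerPotential hf hω⟩
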